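/- Let $(X_i)_{i\in\mathbb{Z}}$ be a strictly stationary sequence of random variables on a probability space $(\Omega,\mathcal{F},\mathbb{P})$ with values in a separable metric space $(S,d)$ endowed with its Borel $\sigma$-algebra, let $\mathbb{H}$ be a separable real Hilbert space endowed with its Borel $\sigma$-algebra, and let $h\colon S\times S\to\mathbb{H}$ be measurable, where $S\times S$ carries the product $\sigma$-algebra. For $n\geq 1$ put $$U_n(h)=\sum_{1\leq i<j\leq n}h(X_i,X_j).$$ For sub-$\sigma$-algebras $\mathcal{A},\mathcal{B}$ of $\mathcal{F}$ let $$\beta(\mathcal{A},\mathcal{B})=\frac12\sup\sum_{i=1}^I\sum_{j=1}^J\left|\mathbb{P}(A_i\cap B_j)-\mathbb{P}(A_i)\mathbb{P}(B_j)\right|,$$ the supremum being over all finite partitions $(A_i)_{i=1}^I$ and $(B_j)_{j=1}^J$ of $\Omega$ into elements of $\mathcal{A}$ and of $\mathcal{B}$ respectively, and for $k\geq 1$ let $$\beta(k)=\sup_{\ell\geq 1}\beta\big(\sigma(X_i,1\leq i\leq \ell),\sigma(X_i,i\geq \ell+k)\big).$$ Let $X_1'$ be an independent copy of $X_1$ (the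 pair $(X_1,X_1')$ being realized on some probability space, possibly other than $\Omega$). Let $1<p<2$ and $\delta>0$ be such that $p+\delta\geq 2$, and suppose that $$\mathbb{E}\big[\|h(X_1,X_1')\|_{\mathbb{H}}^{p+\delta}\big]<\infty,\qquad \sup_{j\geq 2}\mathbb{E}\big[\|h(X_1,X_j)\|_{\mathbb{H}}\big]<\infty,$$ that the kernel is degenerate, i.e. $$\mathbb{E}[h(X_1,X_1')\mid X_1]=\mathbb{E}[h(X_1,X_1')\mid X_1']=0\quad\text{almost surely},$$ and that there exists $\eta>0$ such that $$\sum_{k=1}^\infty k^{\frac{2(p-1)}{2-p}+\eta}\beta(k)<\infty.$$ Then $$\lim_{n\to\infty}\frac{1}{n^{2/p}}\|U_n(h)\|_{\mathbb{H}}=0\quad\text{almost surely}.$$ -/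

import Mathlib

open MeasureTheory ProbabilityTheory Filter Topology
open scoped ENNReal

namespace UStat

/-- A finite partition of `Ω` into elements of the `σ`-algebra `m`, given as a finite family
(some of the cells may be empty). -/
structure IsFinPartition {Ω : Type*} (m : MeasurableSpace Ω) {I : ℕ} (A : Fin I → Set Ω) :
    Prop where
  measurable : ∀ i, MeasurableSet[m] (A i)
  disjoint : Pairwise fun i i' => Disjoint (A i) (A i')
  cover : ⋃ i, A i = Set.univ

/-- The `β`-mixing (absolute regularity) coefficient of two sub-`σ`-algebras `𝒜`, `ℬ`: half the
supremum of `∑ i, ∑ j, |P (A i ∩ B j) - P (A i) * P (B j)|` over all the finite partitions of `Ω`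
by elements of `𝒜` and of `ℬ` respectively. -/
noncomputable def betaCoeff {Ω : Type*} [MeasurableSpace Ω] (P : Measure Ω)
    (𝒜 ℬ : MeasurableSpace Ω) : ℝ≥0∞ :=
  2⁻¹ * ⨆ (I : ℕ) (J : ℕ) (A : Fin I → Set Ω) (B : Fin J → Set Ω)
    (_ : IsFinPartition 𝒜 A) (_ : IsFinPartition ℬ B),
      ∑ i, ∑ j, ENNReal.ofReal |P.real (A i ∩ B j) - P.real (A i) * P.real (B j)|

/-- The `σ`-algebra generated by the random variables `X i`, `i ∈ T`. -/
abbrev sigmaGen {Ω S : Type*} [MeasurableSpace S] (X : ℤ → Ω → S) (T : Set ℤ) :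
    MeasurableSpace Ω :=
  ⨆ i ∈ T, MeasurableSpace.comap (X i) inferInstance

/-- The `β`-mixing coefficients of a sequence:
`β(k) = sup_{ℓ ≥ 1} β(σ(X_i, 1 ≤ i ≤ ℓ), σ(X_i, i ≥ ℓ + k))`. -/
noncomputable def betaMix {Ω S : Type*} [MeasurableSpace Ω] [MeasurableSpace S] (P : Measure Ω)
    (X : ℤ → Ω → S) (k : ℕ) : ℝ≥0∞ :=
  ⨆ (ℓ : ℤ) (_ : 1 ≤ ℓ),
    betaCoeff P (sigmaGen X (Set.Icc 1 ℓ)) (sigmaGen X (Set.Ici (ℓ + k)))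

/-- Strict stationarity: the law of the whole sequence (on the product `σ`-algebra) is invariant
under every shift of the time index. -/
def IsStrictlyStationary {Ω S : Type*} [MeasurableSpace Ω] [MeasurableSpace S] (P : Measure Ω)
    (X : ℤ → Ω → S) : Prop :=
  ∀ k : ℤ, IdentDistrib (fun ω i => X (i + k) ω) (fun ω i => X i ω) P P

/-- The `U`-statistic `U_n(h) = ∑_{1 ≤ i < j ≤ n} h(X_i, X_j)`. -/
noncomputable def uStat {Ω S H : Type*} [AddCommMonoid H] (h : S × S → H) (X : ℤ → Ω → S) (n : ℕ) (ω : Ω) : H :=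
  ∑ ij ∈ (Finset.Icc (1 : ℤ) n ×ˢ Finset.Icc (1 : ℤ) n).filter (fun ij => ij.1 < ij.2),
    h (X ij.1 ω, X ij.2 ω)

end UStat

/-!
The proof works along dyadic scales `n ≤ 2 ^ L`, with gaps of length `q ≈ 2 ^ (α L)`,
`α = 1 - p / 2`.

Call pattern a set of times which is a union of blocks of length at most `2 * q`, repeated with
period `3 * q`, so that consecutive blocks are separated by at least `q`. Patterns obtained by
deleting one residue class modulo `3` of the cells `[k * q, (k + 1) * q)`, or by keeping only one,
satisfy an inclusion–exclusion identity for *pairs* of times (`sum_pattern_sub_sum_pattern`), whence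
`U_n` is a signed sum of six `U`-statistics restricted to a pattern (`uStat_eq_sum_pattern`). It
remains to bound each of these, uniformly in `n ≤ 2 ^ L`.

* Pairs of times in the same block: there are `O(2 ^ L * q)` of them, and the bound on
  `E ‖h (X_1, X_j)‖` with Markov's inequality suffices
  (`measure_exists_patternSum_eq_gt_le`).
* Pairs of times in distinct blocks: no coupling is needed. The probability of an event on the
  `O(2 ^ L / q)` blocks changes by at most `2 * β(q)` per block if the blocks are replaced by
  independent ones (`map_pi_apply_le`); this rests on the approximation of measurable sets of a
  product by finite unions of rectangles (`map_prodMk_apply_le`). For independent blocks, degeneracy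
  makes the kernels of different pairs of blocks orthogonal
  (`integral_inner_pairKernel_eq_zero`), so the second moment of the sum of `h (x_i, x_j)` over
  `i < j` and over `j` in an interval `J` is `O(2 ^ L * q ^ 2 * |J|)`. Being additive in `J`, this
  bound passes to the maximum over `n ≤ 2 ^ L` at the price of a factor `(L + 1) ^ 2`
  (`measure_exists_partialSum_gt_le`).

At the level `2 ^ (2 L / p)` the two kinds of pairs contribute powers of `2 ^ (L (1 + α - 2 / p))`,
and `1 + α - 2 / p = -(2 - p) ^ 2 / (2 p) < 0`; the mixing condition, which gives
`β(q) = O(q ^ (-(s + 1)))` with `s = 2 (p - 1) / (2 - p) + η`, makes the cost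
`2 ^ L * β(q) / q` of the comparison a geometric sequence, since `α (s + 2) > 1`. The
Borel–Cantelli lemma concludes.
-/

set_option linter.unusedSectionVars false

namespace UStat

/-! ### Comparison of a sequence of blocks with independent blocks -/

/-- Every set of the algebra generated by the measurable rectangles is a union of cells of a finite
rectangular grid: it is described by a finite-valued function of each coordinate. -/
lemma exists_grid_of_mem_generateSetAlgebra {U V : Type*} [MeasurableSpace U] [MeasurableSpace V]
    {A : Set (U × V)}
    (hA : A ∈ generateSetAlgebra
      (Set.image2 (· ×ˢ ·) {s : Set U | MeasurableSet s} {t : Set V | MeasurableSet t})) :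
    ∃ (I J : ℕ) (f : U → Fin I) (g : V → Fin J) (R : Finset (Fin I × Fin J)),
      Measurable f ∧ Measurable g ∧ A = {z | (f z.1, g z.2) ∈ R} := by
  classical
  induction hA with
  | base s hs =>
    obtain ⟨a, ha, b, hb, rfl⟩ := hs
    refine ⟨2, 2, fun x => if x ∈ a then 1 else 0, fun y => if y ∈ b then 1 else 0, {(1, 1)},
      Measurable.ite ha measurable_const measurable_const,
      Measurable.ite hb measurable_const measurable_const, ?_⟩
    ext ⟨x, y⟩
    by_cases hx : x ∈ a <;> by_cases hy : y ∈ b <;> simp [hx, hy]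
  | empty => exact ⟨1, 1, fun _ => 0, fun _ => 0, ∅, measurable_const, measurable_const, by simp⟩
  | compl s _ ih =>
    obtain ⟨I, J, f, g, R, hf, hg, rfl⟩ := ih
    exact ⟨I, J, f, g, Rᶜ, hf, hg, by ext z; simp⟩
  | union s t _ _ ihs iht =>
    obtain ⟨I, J, f, g, R, hf, hg, rfl⟩ := ihs
    obtain ⟨I', J', f', g', R', hf', hg', rfl⟩ := iht
    refine ⟨I * I', J * J', fun x => finProdFinEquiv (f x, f' x),
      fun y => finProdFinEquiv (g y, g' y),
      Finset.univ.filter fun e =>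
        ((finProdFinEquiv.symm e.1).1, (finProdFinEquiv.symm e.2).1) ∈ R ∨
        ((finProdFinEquiv.symm e.1).2, (finProdFinEquiv.symm e.2).2) ∈ R',
      (measurable_of_countable (⇑finProdFinEquiv)).comp (hf.prodMk hf'),
      (measurable_of_countable (⇑finProdFinEquiv)).comp (hg.prodMk hg'), ?_⟩
    ext z
    simp only [Set.mem_union, Set.mem_ofPred_eq, Finset.mem_filter, Finset.mem_univ, true_and,
      Equiv.symm_apply_apply]

/-- The defining supremum, freed from its factor `1 / 2`. -/
lemma sum_partition_le_two_mul_betaCoeff {Ω : Type*} {𝒜 ℬ : MeasurableSpace Ω}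
    [MeasurableSpace Ω] (P : Measure Ω) {I J : ℕ} {A : Fin I → Set Ω} {B : Fin J → Set Ω}
    (hA : IsFinPartition 𝒜 A) (hB : IsFinPartition ℬ B) :
    ∑ i, ∑ j, ENNReal.ofReal |P.real (A i ∩ B j) - P.real (A i) * P.real (B j)|
      ≤ 2 * betaCoeff P 𝒜 ℬ := by
  rw [betaCoeff, ← mul_assoc, ENNReal.mul_inv_cancel (by simp) (by simp), one_mul]
  exact le_iSup_of_le I <| le_iSup_of_le J <| le_iSup_of_le A <| le_iSup_of_le B <|
    le_iSup_of_le hA <| le_iSup_of_le hB le_rfl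

lemma isFinPartition_preimage {Ω : Type*} {m : MeasurableSpace Ω} {I : ℕ} {f : Ω → Fin I}
    (hf : Measurable f) : IsFinPartition m fun i => f ⁻¹' {i} where
  measurable i := hf (measurableSet_singleton i)
  disjoint i j hij := Disjoint.preimage f (by simpa using hij)
  cover := by ext; simp

/-- The `β`-mixing coefficient controls the total variation distance between a joint law and the
product of its marginals. The constant `2` is not sharp. -/
lemma map_prodMk_apply_le {Ω U V : Type*} {𝒜 ℬ : MeasurableSpace Ω} [mΩ : MeasurableSpace Ω]
    [MeasurableSpace U] [MeasurableSpace V] (P : Measure Ω) [IsProbabilityMeasure P]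
    (h𝒜 : 𝒜 ≤ mΩ) (hℬ : ℬ ≤ mΩ) {u : Ω → U} {v : Ω → V} (hu : Measurable[𝒜] u)
    (hv : Measurable[ℬ] v) {A : Set (U × V)} (hA : MeasurableSet A) :
    P.map (fun ω => (u ω, v ω)) A ≤ (P.map u).prod (P.map v) A + 2 * betaCoeff P 𝒜 ℬ := by
  have hu' : Measurable u := hu.mono h𝒜 le_rfl
  have hv' : Measurable v := hv.mono hℬ le_rfl
  have : IsProbabilityMeasure (P.map u) := Measure.isProbabilityMeasure_map hu'.aemeasurable
  have : IsProbabilityMeasure (P.map v) := Measure.isProbabilityMeasure_map hv'.aemeasurable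
  set μ₁ := P.map (fun ω => (u ω, v ω)) with hμ₁
  have : IsProbabilityMeasure μ₁ :=
    Measure.isProbabilityMeasure_map (hu'.prodMk hv').aemeasurable
  set μ₂ := (P.map u).prod (P.map v) with hμ₂
  set 𝒢 := generateSetAlgebra
      (Set.image2 (· ×ˢ ·) {s : Set U | MeasurableSet s} {t : Set V | MeasurableSet t}) with h𝒢
  have key : ∀ B ∈ 𝒢, μ₁ B ≤ μ₂ B + 2 * betaCoeff P 𝒜 ℬ := by
    intro B hB
    obtain ⟨I, J, f, g, R, hf, hg, rfl⟩ := exists_grid_of_mem_generateSetAlgebra hB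
    have hfg : Measurable (Prod.map f g) := hf.prodMap hg
    -- the measure of a grid set is the sum over its cells, and each cell is a rectangle
    have e : {z : U × V | (f z.1, g z.2) ∈ R} = Prod.map f g ⁻¹' (R : Set (Fin I × Fin J)) := rfl
    have hsum : ∀ μ : Measure (U × V), μ {z | (f z.1, g z.2) ∈ R}
        = ∑ c ∈ R, μ ((f ⁻¹' {c.1}) ×ˢ (g ⁻¹' {c.2})) := by
      intro μ
      rw [e, ← Measure.map_apply hfg R.measurableSet, ← sum_measure_singleton]
      refine Finset.sum_congr rfl fun c _ => ?_
      rw [Measure.map_apply hfg (measurableSet_singleton c)]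
      congr 1
      ext z
      simp [Prod.ext_iff]
    rw [hsum, hsum]
    have hpt : ∀ c : Fin I × Fin J, μ₁ ((f ⁻¹' {c.1}) ×ˢ (g ⁻¹' {c.2}))
        ≤ μ₂ ((f ⁻¹' {c.1}) ×ˢ (g ⁻¹' {c.2})) +
          ENNReal.ofReal |P.real (((f ∘ u) ⁻¹' {c.1}) ∩ ((g ∘ v) ⁻¹' {c.2})) -
            P.real ((f ∘ u) ⁻¹' {c.1}) * P.real ((g ∘ v) ⁻¹' {c.2})| := by
      intro c
      have h1 := hf (measurableSet_singleton c.1)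
      have h2 := hg (measurableSet_singleton c.2)
      rw [hμ₂, Measure.prod_prod, hμ₁, Measure.map_apply (hu'.prodMk hv') (h1.prod h2),
        Measure.map_apply hu' h1, Measure.map_apply hv' h2]
      have e2 : (fun ω => (u ω, v ω)) ⁻¹' ((f ⁻¹' {c.1}) ×ˢ (g ⁻¹' {c.2}))
        = ((f ∘ u) ⁻¹' {c.1}) ∩ ((g ∘ v) ⁻¹' {c.2}) := rfl
      rw [e2, ← Set.preimage_comp, ← Set.preimage_comp, ← ofReal_measureReal,
        ← ofReal_measureReal (s := (f ∘ u) ⁻¹' {c.1}),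
        ← ofReal_measureReal (s := (g ∘ v) ⁻¹' {c.2}),
        ← ENNReal.ofReal_mul measureReal_nonneg,
        ← ENNReal.ofReal_add (by positivity) (by positivity)]
      apply ENNReal.ofReal_le_ofReal
      linarith [le_abs_self (P.real (((f ∘ u) ⁻¹' {c.1}) ∩ ((g ∘ v) ⁻¹' {c.2})) -
            P.real ((f ∘ u) ⁻¹' {c.1}) * P.real ((g ∘ v) ⁻¹' {c.2}))]
    refine (Finset.sum_le_sum fun c _ => hpt c).trans ?_
    rw [Finset.sum_add_distrib]
    gcongr
    refine (Finset.sum_le_univ_sum_of_nonneg fun _ => zero_le).trans ?_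
    rw [Fintype.sum_prod_type]
    have hfu : IsFinPartition 𝒜 fun i => (f ∘ u) ⁻¹' {i} :=
      @isFinPartition_preimage _ 𝒜 _ _ (hf.comp hu)
    have hgv : IsFinPartition ℬ fun j => (g ∘ v) ⁻¹' {j} :=
      @isFinPartition_preimage _ ℬ _ _ (hg.comp hv)
    have h4 := sum_partition_le_two_mul_betaCoeff P hfu hgv
    exact h4
  -- a measurable set is approximated by grid sets for both laws simultaneously
  have hdense : Measure.MeasureDense (μ₁ + μ₂) 𝒢 :=
    Measure.MeasureDense.of_generateFrom_isSetAlgebra_finite _ isSetAlgebra_generateSetAlgebra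
      (by rw [h𝒢, generateFrom_generateSetAlgebra_eq, generateFrom_prod])
  refine ENNReal.le_of_forall_pos_le_add fun ε hε _ => ?_
  obtain ⟨B, hB, hAB⟩ := hdense.approx A hA (measure_ne_top _ _) (ε / 2) (by positivity)
  rw [Measure.add_apply] at hAB
  have h1 : μ₁ A ≤ μ₁ B + μ₁ (symmDiff A B) := by
    refine (measure_mono ?_).trans (measure_union_le _ _)
    intro z hz
    by_cases hzB : z ∈ B
    · exact Or.inl hzB
    · exact Or.inr (Or.inl ⟨hz, hzB⟩)
  have h2 : μ₂ B ≤ μ₂ A + μ₂ (symmDiff A B) := by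
    refine (measure_mono ?_).trans (measure_union_le _ _)
    intro z hz
    by_cases hzA : z ∈ A
    · exact Or.inl hzA
    · exact Or.inr (Or.inr ⟨hz, hzA⟩)
  have h3 : μ₁ (symmDiff A B) + μ₂ (symmDiff A B) ≤ ε := by
    refine hAB.le.trans ?_
    rw [ENNReal.ofReal_div_of_pos two_pos, ENNReal.ofReal_coe_nnreal]
    exact ENNReal.div_le_of_le_mul (le_mul_of_one_le_right' (by simp))
  calc μ₁ A ≤ μ₁ B + μ₁ (symmDiff A B) := h1
    _ ≤ μ₂ A + μ₂ (symmDiff A B) + 2 * betaCoeff P 𝒜 ℬ + μ₁ (symmDiff A B) := by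
        gcongr
        exact (key B hB).trans (by gcongr)
    _ = μ₂ A + 2 * betaCoeff P 𝒜 ℬ + (μ₁ (symmDiff A B) + μ₂ (symmDiff A B)) := by ring
    _ ≤ _ := by gcongr

/-- If each block `Z b` is `κ`-close to being independent of its past, then the law of the first
`m` blocks is close to the product law, with an error of `2 * κ` per block. -/
lemma map_pi_apply_le {Ω T : Type*} [mΩ : MeasurableSpace Ω] [MeasurableSpace T]
    (P : Measure Ω) [IsProbabilityMeasure P] {Z : ℕ → Ω → T} (μ : Measure T)
    [IsProbabilityMeasure μ] (hlaw : ∀ b, P.map (Z b) = μ) {κ : ℝ≥0∞}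
    (hZ : ∀ b, ∃ 𝒜 ℬ : MeasurableSpace Ω, 𝒜 ≤ mΩ ∧ ℬ ≤ mΩ ∧ (∀ c < b, Measurable[𝒜] (Z c)) ∧
      Measurable[ℬ] (Z b) ∧ @betaCoeff Ω mΩ P 𝒜 ℬ ≤ κ) (m : ℕ) {A : Set (Fin m → T)}
    (hA : MeasurableSet A) :
    P.map (fun ω (b : Fin m) => Z b ω) A ≤ Measure.pi (fun _ => μ) A + m * (2 * κ) := by
  have hZm : ∀ b, Measurable (Z b) := fun b => by
    obtain ⟨_, ℬ, _, hℬ, _, hb, _⟩ := hZ b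
    exact hb.mono hℬ le_rfl
  have hstep : ∀ (m : ℕ) (B : Set ((Fin m → T) × T)), MeasurableSet B →
      P.map (fun ω => ((fun b : Fin m => Z b ω), Z m ω)) B
        ≤ ((P.map fun ω (b : Fin m) => Z b ω).prod (P.map (Z m))) B + 2 * κ := by
    intro m B hB
    obtain ⟨𝒜, ℬ, h𝒜, hℬ, hpast, hb, hβ⟩ := hZ m
    exact (@map_prodMk_apply_le _ _ _ 𝒜 ℬ mΩ _ _ P _ h𝒜 hℬ
      (fun ω (b : Fin m) => Z b ω) _ (@measurable_pi_lambda _ _ _ 𝒜 _ _ fun b => hpast b b.2) hb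
      B hB).trans
      (by gcongr)
  induction m with
  | zero =>
    have hm : Measurable (fun ω (b : Fin 0) => Z b ω) := measurable_pi_lambda _ fun b => hZm b
    rcases (Set.subsingleton_of_subsingleton (s := A)).eq_empty_or_singleton with
      h | ⟨x, hx⟩
    · simp [h]
    · have : A = Set.univ := by
        rw [hx]; ext y; simp [Subsingleton.elim y x]
      rw [this]
      have := Measure.isProbabilityMeasure_map (μ := P) hm.aemeasurable
      simp
  | succ m ih =>
    let e := MeasurableEquiv.piFinSuccAbove (fun _ : Fin (m + 1) => T) (Fin.last m)
    have he : MeasurePreserving e (Measure.pi fun _ => μ) (μ.prod (Measure.pi fun _ => μ)) :=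
      measurePreserving_piFinSuccAbove (fun _ => μ) (Fin.last m)
    have hm : Measurable (fun ω (b : Fin m) => Z b ω) := measurable_pi_lambda _ fun b => hZm b
    have hm1 : Measurable (fun ω (b : Fin (m + 1)) => Z b ω) :=
      measurable_pi_lambda _ fun b => hZm b
    let A' : Set ((Fin m → T) × T) := Prod.swap ⁻¹' (e.symm ⁻¹' A)
    have hA' : MeasurableSet A' := measurable_swap (e.symm.measurable hA)
    have h1 : P.map (fun ω (b : Fin (m + 1)) => Z b ω) A
        = P.map (fun ω => ((fun b : Fin m => Z b ω), Z m ω)) A' := by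
      rw [Measure.map_apply hm1 hA, Measure.map_apply (hm.prodMk (hZm m)) hA']
      congr 1
      ext ω
      have : (fun b : Fin (m + 1) => Z b ω) = e.symm (Z m ω, fun b : Fin m => Z b ω) := by
        rw [MeasurableEquiv.eq_symm_apply]
        ext <;> simp [e, MeasurableEquiv.piFinSuccAbove, Fin.insertNthEquiv, Fin.init]
      simp only [Set.mem_preimage, A']
      rw [this]
      rfl
    have h2 : Measure.pi (fun _ => μ) A = ((Measure.pi fun _ : Fin m => μ).prod μ) A' := by
      rw [← Measure.prod_swap, Measure.map_apply measurable_swap hA']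
      have : Prod.swap ⁻¹' A' = e.symm ⁻¹' A := rfl
      rw [this]
      exact (he.symm.measure_preimage hA.nullMeasurableSet).symm
    rw [h1, h2]
    refine (hstep m A' hA').trans ?_
    have : IsProbabilityMeasure (P.map fun ω (b : Fin m) => Z b ω) :=
      Measure.isProbabilityMeasure_map hm.aemeasurable
    have h3 : ((P.map fun ω (b : Fin m) => Z b ω).prod (P.map (Z m))) A'
        ≤ ((Measure.pi fun _ : Fin m => μ).prod μ) A' + m * (2 * κ) := by
      rw [hlaw, Measure.prod_apply_symm hA', Measure.prod_apply_symm hA']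
      calc _ ≤ ∫⁻ y, (Measure.pi (fun _ => μ) ((fun x => (x, y)) ⁻¹' A') + m * (2 * κ)) ∂μ :=
            lintegral_mono fun y => ih (measurable_prodMk_right hA')
        _ = _ := by rw [lintegral_add_right _ measurable_const]; simp
    calc _ ≤ ((Measure.pi fun _ : Fin m => μ).prod μ) A' + m * (2 * κ) + 2 * κ := by gcongr
      _ = _ := by push_cast; ring

/-! ### A dyadic maximal inequality -/

section Dyadic

variable {H : Type*} [NormedAddCommGroup H]

/-- The sum of `‖∑ j ∈ J, D j‖ ^ 2` over all the dyadic subintervals `J` of `[a, a + 2 ^ L)`. -/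
noncomputable def dyadicEnergy (D : ℕ → H) : ℕ → ℕ → ℝ
  | 0, a => ‖D a‖ ^ 2
  | L + 1, a => ‖∑ j ∈ Finset.Ico a (a + 2 ^ (L + 1)), D j‖ ^ 2 + dyadicEnergy D L a
      + dyadicEnergy D L (a + 2 ^ L)

lemma dyadicEnergy_nonneg (D : ℕ → H) (L a : ℕ) : 0 ≤ dyadicEnergy D L a := by
  induction L generalizing a with
  | zero => exact sq_nonneg _
  | succ L ih =>
    have := ih a
    have := ih (a + 2 ^ L)
    rw [dyadicEnergy]
    positivity

lemma norm_sq_sum_le_dyadicEnergy (D : ℕ → H) (L a : ℕ) :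
    ‖∑ j ∈ Finset.Ico a (a + 2 ^ L), D j‖ ^ 2 ≤ dyadicEnergy D L a := by
  cases L with
  | zero => simp [dyadicEnergy]
  | succ L =>
    have := dyadicEnergy_nonneg D L a
    have := dyadicEnergy_nonneg D L (a + 2 ^ L)
    rw [dyadicEnergy]
    linarith

/-- All the partial sums over `[a, a + 2 ^ L)` are controlled by the dyadic ones. -/
lemma norm_sq_partialSum_le (D : ℕ → H) (L a n : ℕ) (hn : n ≤ 2 ^ L) :
    ‖∑ j ∈ Finset.Ico a (a + n), D j‖ ^ 2 ≤ (L + 1) * dyadicEnergy D L a := by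
  induction L generalizing a n with
  | zero =>
    have : n = 0 ∨ n = 1 := by simp at hn; omega
    rcases this with rfl | rfl <;> simp [dyadicEnergy]
  | succ L ih =>
    have h0 := dyadicEnergy_nonneg D L a
    have h1 := dyadicEnergy_nonneg D L (a + 2 ^ L)
    have h2 := norm_sq_sum_le_dyadicEnergy D L a
    have hsucc : dyadicEnergy D L a + dyadicEnergy D L (a + 2 ^ L) ≤ dyadicEnergy D (L + 1) a := by
      rw [dyadicEnergy]
      nlinarith [sq_nonneg ‖∑ j ∈ Finset.Ico a (a + 2 ^ (L + 1)), D j‖]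
    push_cast
    have hL : (0 : ℝ) ≤ L := Nat.cast_nonneg L
    rcases le_or_gt n (2 ^ L) with hn' | hn'
    · have := ih a n hn'
      nlinarith
    · obtain ⟨k, rfl⟩ := Nat.exists_eq_add_of_lt hn'
      have h3 := ih (a + 2 ^ L) (k + 1) (by rw [pow_succ] at hn; omega)
      have hsplit : ∑ j ∈ Finset.Ico a (a + (2 ^ L + k + 1)), D j
          = ∑ j ∈ Finset.Ico a (a + 2 ^ L), D j
            + ∑ j ∈ Finset.Ico (a + 2 ^ L) (a + 2 ^ L + (k + 1)), D j := by
        rw [Finset.sum_Ico_consecutive _ (by omega) (by omega)]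
        congr 2
        omega
      rw [hsplit]
      set x := ∑ j ∈ Finset.Ico a (a + 2 ^ L), D j
      set y := ∑ j ∈ Finset.Ico (a + 2 ^ L) (a + 2 ^ L + (k + 1)), D j
      have hxy : ‖x + y‖ ^ 2 ≤ (‖x‖ + ‖y‖) ^ 2 := by gcongr; exact norm_add_le x y
      -- `(x + y)² ≤ (L + 2) x² + (1 + 1 / (L + 1)) y²`
      have hconv : (L + 1) * (‖x‖ + ‖y‖) ^ 2
          ≤ (L + 1) * ((L + 2) * ‖x‖ ^ 2) + (L + 2) * ‖y‖ ^ 2 := by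
        nlinarith [sq_nonneg ((L + 1) * ‖x‖ - ‖y‖)]
      have : (L + 1) * (‖x‖ + ‖y‖) ^ 2
          ≤ (L + 1) * ((L + 2) * (dyadicEnergy D L a + dyadicEnergy D L (a + 2 ^ L))) := by
        refine hconv.trans ?_
        have e1 : (L + 1) * ((L + 2) * ‖x‖ ^ 2) ≤ (L + 1) * ((L + 2) * dyadicEnergy D L a) := by
          gcongr
        have e2 : (L + 2) * ‖y‖ ^ 2
            ≤ (L + 2) * ((L + 1) * dyadicEnergy D L (a + 2 ^ L)) := by gcongr
        linarith
      have h4 := le_of_mul_le_mul_left this (by positivity)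
      have h5 : ((L : ℝ) + 2) * (dyadicEnergy D L a + dyadicEnergy D L (a + 2 ^ L))
          ≤ (L + 2) * dyadicEnergy D (L + 1) a := by gcongr
      linarith

variable {Θ : Type*} [MeasurableSpace Θ] {π : Measure Θ}

lemma integrable_dyadicEnergy {D : ℕ → Θ → H} (hD : ∀ j, MemLp (D j) 2 π) (L a : ℕ) :
    Integrable (fun x => dyadicEnergy (fun j => D j x) L a) π := by
  induction L generalizing a with
  | zero => exact (hD a).integrable_norm_pow two_ne_zero
  | succ L ih =>
    have hS : MemLp (fun x => ∑ j ∈ Finset.Ico a (a + 2 ^ (L + 1)), D j x) 2 π :=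
      memLp_finsetSum _ fun j _ => hD j
    exact ((hS.integrable_norm_pow two_ne_zero).add (ih a)).add (ih _)

lemma integral_dyadicEnergy_le {D : ℕ → Θ → H} (hD : ∀ j, MemLp (D j) 2 π) {C : ℝ} (N : ℕ)
    (hC : ∀ a b, a ≤ b → b ≤ N →
      ∫ x, ‖∑ j ∈ Finset.Ico a b, D j x‖ ^ 2 ∂π ≤ C * (b - a : ℝ))
    (L a : ℕ) (ha : a + 2 ^ L ≤ N) :
    ∫ x, dyadicEnergy (fun j => D j x) L a ∂π ≤ (L + 1) * (C * 2 ^ L) := by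
  induction L generalizing a with
  | zero => simpa [dyadicEnergy] using hC a (a + 1) (by omega) (by simpa using ha)
  | succ L ih =>
    have hS : MemLp (fun x => ∑ j ∈ Finset.Ico a (a + 2 ^ (L + 1)), D j x) 2 π :=
      memLp_finsetSum _ fun j _ => hD j
    have hS2 := hS.integrable_norm_pow two_ne_zero
    have i1 := integrable_dyadicEnergy hD L a
    have i2 := integrable_dyadicEnergy hD L (a + 2 ^ L)
    simp only [dyadicEnergy]
    rw [pow_succ] at ha
    have e : ∫ x, (‖∑ j ∈ Finset.Ico a (a + 2 ^ (L + 1)), D j x‖ ^ 2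
        + dyadicEnergy (fun j => D j x) L a + dyadicEnergy (fun j => D j x) L (a + 2 ^ L)) ∂π
        = ∫ x, ‖∑ j ∈ Finset.Ico a (a + 2 ^ (L + 1)), D j x‖ ^ 2 ∂π
        + ∫ x, dyadicEnergy (fun j => D j x) L a ∂π
        + ∫ x, dyadicEnergy (fun j => D j x) L (a + 2 ^ L) ∂π := by
      rw [← integral_add hS2 i1]
      exact integral_add (hS2.add i1) i2
    rw [e]
    have h1 := ih a (by omega)
    have h2 := ih (a + 2 ^ L) (by omega)
    have h3 := hC a (a + 2 ^ (L + 1)) (by omega) (by rw [pow_succ]; omega)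
    push_cast at h3 ⊢
    rw [add_sub_cancel_left] at h3
    have h4 : (2 : ℝ) ^ (L + 1) = 2 * 2 ^ L := by ring
    rw [h4] at h3 ⊢
    linarith

/-- A maximal inequality of Rademacher–Menshov type: if the second moment of a sum over an interval
is at most proportional to the length of the interval, then the maximum of the partial sums is
controlled up to a squared logarithm. -/
lemma measure_exists_partialSum_gt_le [IsFiniteMeasure π] {D : ℕ → Θ → H}
    (hD : ∀ j, MemLp (D j) 2 π) {C : ℝ} (L : ℕ)
    (hC : ∀ a b, a ≤ b → b ≤ 2 ^ L →
      ∫ x, ‖∑ j ∈ Finset.Ico a b, D j x‖ ^ 2 ∂π ≤ C * (b - a : ℝ)) {t : ℝ} (ht : 0 < t) :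
    π {x | ∃ n ≤ 2 ^ L, t < ‖∑ j ∈ Finset.range n, D j x‖}
      ≤ ENNReal.ofReal ((L + 1) ^ 2 * (C * 2 ^ L) / t ^ 2) := by
  have hint := integrable_dyadicEnergy hD L 0
  have hE := integral_dyadicEnergy_le hD (2 ^ L) hC L 0 (by simp)
  have hsub : {x | ∃ n ≤ 2 ^ L, t < ‖∑ j ∈ Finset.range n, D j x‖}
      ⊆ {x | t ^ 2 / (L + 1) ≤ dyadicEnergy (fun j => D j x) L 0} := by
    rintro x ⟨n, hn, hx⟩
    have := norm_sq_partialSum_le (fun j => D j x) L 0 n hn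
    rw [zero_add, ← Finset.range_eq_Ico] at this
    show t ^ 2 / (L + 1) ≤ _
    rw [div_le_iff₀' (by positivity)]
    exact le_trans (by gcongr) this
  refine (measure_mono hsub).trans ?_
  rw [← ofReal_measureReal]
  apply ENNReal.ofReal_le_ofReal
  have hM := mul_meas_ge_le_integral_of_nonneg
    (ae_of_all π fun x => dyadicEnergy_nonneg (fun j => D j x) L 0) hint (t ^ 2 / (L + 1))
  rw [div_mul_eq_mul_div, div_le_iff₀' (by positivity)] at hM
  rw [le_div_iff₀' (by positivity)]
  refine hM.trans ?_
  calc ((L : ℝ) + 1) * ∫ x, dyadicEnergy (fun j => D j x) L 0 ∂π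
      ≤ (L + 1) * ((L + 1) * (C * 2 ^ L)) := by gcongr
    _ = _ := by ring

end Dyadic

/-! ### Second moments of degenerate kernels of independent blocks -/

section SecondMoment

variable {S H : Type*} [MeasurableSpace S] [NormedAddCommGroup H] [InnerProductSpace ℝ H]
  [CompleteSpace H] [SecondCountableTopology H] [MeasurableSpace H] [BorelSpace H]
  {ν : Measure S} [IsProbabilityMeasure ν] {h : S × S → H}

lemma integrable_inner_of_memLp {Θ : Type*} [MeasurableSpace Θ] {π : Measure Θ} {f g : Θ → H}
    (hf : MemLp f 2 π) (hg : MemLp g 2 π) : Integrable (fun x => inner ℝ (f x) (g x)) π := by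
  refine Integrable.mono' ((hf.integrable_norm_pow two_ne_zero).add
    (hg.integrable_norm_pow two_ne_zero)) (hf.1.inner hg.1) (ae_of_all _ fun x => ?_)
  have := norm_inner_le_norm (𝕜 := ℝ) (f x) (g x)
  simp only [Pi.add_apply]
  nlinarith [sq_nonneg (‖f x‖ - ‖g x‖), norm_nonneg (f x), norm_nonneg (g x)]

/-- The square integrable kernel `h` is degenerate for the law `ν`: integrating out either variable
gives zero. -/
structure IsDegenerate (ν : Measure S) (h : S × S → H) : Prop where
  measurable : Measurable h
  memLp : MemLp h 2 (ν.prod ν)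
  ae_right : ∀ᵐ x ∂ν, ∫ y, h (x, y) ∂ν = 0
  ae_left : ∀ᵐ y ∂ν, ∫ x, h (x, y) ∂ν = 0

lemma IsDegenerate.swap (hd : IsDegenerate ν h) : IsDegenerate ν (h ∘ Prod.swap) where
  measurable := hd.measurable.comp measurable_swap
  memLp := hd.memLp.comp_measurePreserving Measure.measurePreserving_swap
  ae_right := hd.ae_left
  ae_left := hd.ae_right

/-- A degenerate kernel is orthogonal to everything that does not depend on its second argument. -/
lemma IsDegenerate.integral_inner_eq_zero (hd : IsDegenerate ν h) {Θ : Type*} [MeasurableSpace Θ]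
    {π : Measure Θ} [IsProbabilityMeasure π] {u y : Θ → S} {g : Θ → H} (hu : Measurable u)
    (hy : Measurable y) (hg : Measurable g) (hul : π.map u = ν) (hyl : π.map y = ν)
    (hind : IndepFun y (fun x => (u x, g x)) π)
    (hint : Integrable (fun x => inner ℝ (g x) (h (u x, y x))) π) :
    ∫ x, inner ℝ (g x) (h (u x, y x)) ∂π = 0 := by
  have hug : Measurable fun x => (u x, g x) := hu.prodMk hg
  set ρ := π.map (fun x => (u x, g x)) with hρ
  have : IsProbabilityMeasure ρ := Measure.isProbabilityMeasure_map hug.aemeasurable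
  have hmap : π.map (fun x => (y x, (u x, g x))) = ν.prod ρ := by
    rw [(indepFun_iff_map_prod_eq_prod_map_map hy.aemeasurable hug.aemeasurable).1 hind, hyl]
  let G : S × (S × H) → ℝ := fun z => inner ℝ z.2.2 (h (z.2.1, z.1))
  have hG : Measurable G :=
    (measurable_snd.comp measurable_snd).inner (hd.measurable.comp
      ((measurable_fst.comp measurable_snd).prodMk measurable_fst))
  have hGint : Integrable G (ν.prod ρ) := by
    rw [← hmap, integrable_map_measure hG.aestronglyMeasurable (hy.prodMk hug).aemeasurable]
    exact hint
  have e : ∫ x, inner ℝ (g x) (h (u x, y x)) ∂π = ∫ z, G z ∂(ν.prod ρ) := by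
    rw [← hmap, integral_map (hy.prodMk hug).aemeasurable hG.aestronglyMeasurable]
  rw [e, integral_prod_symm _ hGint]
  have hh : Integrable h (ν.prod ν) := hd.memLp.integrable (by norm_num)
  have hmarg : ρ.map Prod.fst = ν := by
    rw [hρ, Measure.map_map measurable_fst hug]
    exact hul
  have h1 : ∀ᵐ w ∂ρ, Integrable (fun y => h (w.1, y)) ν ∧ ∫ y, h (w.1, y) ∂ν = 0 := by
    have : ∀ᵐ a ∂(ρ.map Prod.fst), Integrable (fun y => h (a, y)) ν ∧ ∫ y, h (a, y) ∂ν = 0 := by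
      rw [hmarg]
      exact hh.prod_right_ae.and hd.ae_right
    exact ae_of_ae_map measurable_fst.aemeasurable this
  refine integral_eq_zero_of_ae ?_
  filter_upwards [h1] with w hw
  simp only [G, Pi.zero_apply]
  rw [integral_inner hw.1, hw.2, inner_zero_right]

variable {ι T : Type*} [Fintype ι] [LinearOrder ι] [MeasurableSpace T] {μ : Measure T}
  [IsProbabilityMeasure μ]

lemma indepFun_eval_pi (c : ι) (s : Finset ι) (hc : c ∉ s) :
    IndepFun (fun x : ι → T => x c) (fun x (i : s) => x i) (Measure.pi fun _ => μ) := by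
  have h1 : iIndepFun (fun i (x : ι → T) => x i) (Measure.pi fun _ => μ) :=
    iIndepFun_pi (X := fun _ => id) fun _ => aemeasurable_id
  have h2 := h1.indepFun_finset {c} s (by simpa using hc) fun i => measurable_pi_apply i
  exact h2.comp (φ := fun z : ({c} : Finset ι) → T => z ⟨c, by simp⟩)
    (measurable_pi_apply _) measurable_id

/-- The kernel at the times `e.1` and `e.2`, where the variable at time `i` is a function `φ i` of
the block number `b i`. -/
def pairKernel (h : S × S → H) (φ : ℕ → T → S) (b : ℕ → ι) (e : ℕ × ℕ) (x : ι → T) : H :=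
  h (φ e.1 (x (b e.1)), φ e.2 (x (b e.2)))

variable {φ : ℕ → T → S} {b : ℕ → ι}

lemma measurable_pairKernel (hd : IsDegenerate ν h) (hφ : ∀ i, Measurable (φ i)) (e : ℕ × ℕ) :
    Measurable (pairKernel h φ b e) :=
  hd.measurable.comp (((hφ _).comp (measurable_pi_apply _)).prodMk
    ((hφ _).comp (measurable_pi_apply _)))

lemma map_block_eq (hφ : ∀ i, Measurable (φ i)) (hφν : ∀ i, μ.map (φ i) = ν) (i : ℕ) :
    (Measure.pi fun _ : ι => μ).map (fun x => φ i (x (b i))) = ν := by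
  have := Measure.map_map (μ := Measure.pi fun _ : ι => μ) (hφ i) (measurable_pi_apply (b i))
  rw [(measurePreserving_eval (fun _ : ι => μ) (b i)).map_eq, hφν] at this
  exact this.symm

lemma measurePreserving_pair (hφ : ∀ i, Measurable (φ i)) (hφν : ∀ i, μ.map (φ i) = ν)
    {e : ℕ × ℕ} (he : b e.1 ≠ b e.2) :
    MeasurePreserving (fun x : ι → T => (φ e.1 (x (b e.1)), φ e.2 (x (b e.2))))
      (Measure.pi fun _ => μ) (ν.prod ν) := by
  have hm : ∀ i, Measurable fun x : ι → T => φ i (x (b i)) :=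
    fun i => (hφ i).comp (measurable_pi_apply _)
  refine ⟨(hm _).prodMk (hm _), ?_⟩
  have h1 := indepFun_eval_pi (μ := μ) (b e.1) {b e.2} (by simpa using he)
  have h2 : IndepFun (fun x : ι → T => φ e.1 (x (b e.1))) (fun x => φ e.2 (x (b e.2)))
      (Measure.pi fun _ => μ) :=
    h1.comp (φ := φ e.1) (ψ := fun z : ({b e.2} : Finset ι) → T => φ e.2 (z ⟨b e.2, by simp⟩))
      (hφ _)
      ((hφ _).comp (measurable_pi_apply _))
  rw [(indepFun_iff_map_prod_eq_prod_map_map (hm _).aemeasurable (hm _).aemeasurable).1 h2,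
    map_block_eq hφ hφν, map_block_eq hφ hφν]

lemma memLp_pairKernel (hd : IsDegenerate ν h) (hφ : ∀ i, Measurable (φ i))
    (hφν : ∀ i, μ.map (φ i) = ν) {e : ℕ × ℕ} (he : b e.1 ≠ b e.2) :
    MemLp (pairKernel h φ b e) 2 (Measure.pi fun _ => μ) :=
  hd.memLp.comp_measurePreserving (measurePreserving_pair hφ hφν he)

lemma integral_norm_sq_pairKernel (hd : IsDegenerate ν h) (hφ : ∀ i, Measurable (φ i))
    (hφν : ∀ i, μ.map (φ i) = ν) {e : ℕ × ℕ} (he : b e.1 ≠ b e.2) :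
    ∫ x, ‖pairKernel h φ b e x‖ ^ 2 ∂(Measure.pi fun _ => μ)
      = ∫ z, ‖h z‖ ^ 2 ∂(ν.prod ν) := by
  have hmp := measurePreserving_pair (μ := μ) hφ hφν he
  rw [← hmp.map_eq, integral_map hmp.measurable.aemeasurable
    (hd.measurable.norm.pow_const 2).aestronglyMeasurable]
  rfl

/-- Two kernels of pairs of blocks are orthogonal unless the pairs of blocks coincide: one of the
blocks then occurs only once. -/
lemma integral_inner_pairKernel_eq_zero (hd : IsDegenerate ν h) (hφ : ∀ i, Measurable (φ i))
    (hφν : ∀ i, μ.map (φ i) = ν) {e e' : ℕ × ℕ} (he : b e.1 < b e.2) (he' : b e'.1 < b e'.2)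
    (hne : ¬(b e.1 = b e'.1 ∧ b e.2 = b e'.2)) :
    ∫ x, inner ℝ (pairKernel h φ b e x) (pairKernel h φ b e' x) ∂(Measure.pi fun _ => μ) = 0 := by
  have hm : ∀ i, Measurable fun x : ι → T => φ i (x (b i)) :=
    fun i => (hφ i).comp (measurable_pi_apply _)
  have hint : ∀ {e e' : ℕ × ℕ}, b e.1 < b e.2 → b e'.1 < b e'.2 →
      Integrable (fun x => inner ℝ (pairKernel h φ b e x) (pairKernel h φ b e' x))
        (Measure.pi fun _ => μ) := fun he he' =>
    integrable_inner_of_memLp (memLp_pairKernel hd hφ hφν he.ne)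
      (memLp_pairKernel hd hφ hφν he'.ne)
  -- a block that is absent from a finite set of blocks is independent of these
  have hind : ∀ (i k : ℕ) (e : ℕ × ℕ), b i ≠ b k → b i ≠ b e.1 → b i ≠ b e.2 →
      IndepFun (fun x : ι → T => φ i (x (b i)))
        (fun x => (φ k (x (b k)), pairKernel h φ b e x)) (Measure.pi fun _ => μ) := by
    intro i k e h1 h2 h3
    have h4 := indepFun_eval_pi (μ := μ) (b i) {b k, b e.1, b e.2} (by simp [h1, h2, h3])
    exact h4.comp (φ := φ i) (ψ := fun z : ({b k, b e.1, b e.2} : Finset ι) → T =>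
      (φ k (z ⟨b k, by simp⟩), h (φ e.1 (z ⟨b e.1, by simp⟩), φ e.2 (z ⟨b e.2, by simp⟩)))) (hφ _)
      (((hφ _).comp (measurable_pi_apply _)).prodMk (hd.measurable.comp
        (((hφ _).comp (measurable_pi_apply _)).prodMk ((hφ _).comp (measurable_pi_apply _)))))
  have hright : ∀ {e e' : ℕ × ℕ}, b e.1 < b e.2 → b e'.1 < b e'.2 → b e'.2 ≠ b e.1 →
      b e'.2 ≠ b e.2 →
      ∫ x, inner ℝ (pairKernel h φ b e x) (pairKernel h φ b e' x)
        ∂(Measure.pi fun _ => μ) = 0 := fun {e e'} he he' h1 h2 =>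
    hd.integral_inner_eq_zero (hm e'.1) (hm e'.2) (measurable_pairKernel hd hφ e)
      (map_block_eq hφ hφν _) (map_block_eq hφ hφν _) (hind _ _ _ he'.ne' h1 h2) (hint he he')
  by_cases h2 : b e.2 = b e'.2
  · have h1 : b e'.1 ≠ b e.1 := fun h1 => hne ⟨h1.symm, h2⟩
    exact hd.swap.integral_inner_eq_zero (hm e'.2) (hm e'.1) (measurable_pairKernel hd hφ e)
      (map_block_eq hφ hφν _) (map_block_eq hφ hφν _)
      (hind _ _ _ he'.ne h1 (h2 ▸ he'.ne)) (hint he he')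
  · rcases lt_or_gt_of_ne h2 with h3 | h3
    · exact hright he he' (he.trans h3).ne' (Ne.symm h2)
    · simp_rw [real_inner_comm (pairKernel h φ b e' _)]
      exact hright he' he (he'.trans h3).ne' h2

/-- The second moment of a sum of kernels over a set `E` of pairs of times, when no pair of blocks
carries more than `W` of these pairs. -/
lemma integral_norm_sq_sum_le (hd : IsDegenerate ν h) (hφ : ∀ i, Measurable (φ i))
    (hφν : ∀ i, μ.map (φ i) = ν) (E : Finset (ℕ × ℕ)) (hE : ∀ e ∈ E, b e.1 < b e.2) {W : ℝ}
    (hW : ∀ e ∈ E, ((E.filter fun e' => b e.1 = b e'.1 ∧ b e.2 = b e'.2).card : ℝ) ≤ W) :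
    ∫ x, ‖∑ e ∈ E, pairKernel h φ b e x‖ ^ 2 ∂(Measure.pi fun _ => μ)
      ≤ (∫ z, ‖h z‖ ^ 2 ∂(ν.prod ν)) * (E.card * W) := by
  set K := ∫ z, ‖h z‖ ^ 2 ∂(ν.prod ν) with hK
  have hK0 : 0 ≤ K := integral_nonneg fun _ => by positivity
  have hL : ∀ e ∈ E, MemLp (pairKernel h φ b e) 2 (Measure.pi fun _ => μ) :=
    fun e he => memLp_pairKernel hd hφ hφν (hE e he).ne
  have hint : ∀ e ∈ E, ∀ e' ∈ E, Integrable
      (fun x => inner ℝ (pairKernel h φ b e x) (pairKernel h φ b e' x)) (Measure.pi fun _ => μ) :=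
    fun e he e' he' => integrable_inner_of_memLp (hL e he) (hL e' he')
  have hterm : ∀ e ∈ E, ∀ e' ∈ E,
      ∫ x, inner ℝ (pairKernel h φ b e x) (pairKernel h φ b e' x) ∂(Measure.pi fun _ => μ)
        ≤ if b e.1 = b e'.1 ∧ b e.2 = b e'.2 then K else 0 := by
    intro e he e' he'
    split_ifs with hc
    · have h1 := (hL e he).integrable_norm_pow two_ne_zero
      have h2 := (hL e' he').integrable_norm_pow two_ne_zero
      calc _ ≤ ∫ x, (‖pairKernel h φ b e x‖ ^ 2 / 2 + ‖pairKernel h φ b e' x‖ ^ 2 / 2)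
              ∂(Measure.pi fun _ => μ) := by
            refine integral_mono (hint e he e' he') ((h1.div_const 2).add (h2.div_const 2)) ?_
            intro x
            have := real_inner_le_norm (pairKernel h φ b e x) (pairKernel h φ b e' x)
            have := sq_nonneg (‖pairKernel h φ b e x‖ - ‖pairKernel h φ b e' x‖)
            simp only
            nlinarith
        _ = K := by
            rw [integral_add (h1.div_const 2) (h2.div_const 2), integral_div, integral_div,
              integral_norm_sq_pairKernel hd hφ hφν (hE e he).ne,
              integral_norm_sq_pairKernel hd hφ hφν (hE e' he').ne]
            ring
    · exact (integral_inner_pairKernel_eq_zero hd hφ hφν (hE e he) (hE e' he') hc).le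
  calc ∫ x, ‖∑ e ∈ E, pairKernel h φ b e x‖ ^ 2 ∂(Measure.pi fun _ => μ)
      = ∑ e ∈ E, ∑ e' ∈ E,
        ∫ x, inner ℝ (pairKernel h φ b e x) (pairKernel h φ b e' x) ∂(Measure.pi fun _ => μ) := by
        simp_rw [← real_inner_self_eq_norm_sq, sum_inner, inner_sum]
        rw [integral_finsetSum _ fun e he => integrable_finsetSum _ fun e' he' => hint e he e' he']
        exact Finset.sum_congr rfl fun e he => integral_finsetSum _ fun e' he' => hint e he e' he'
    _ ≤ ∑ e ∈ E, ∑ e' ∈ E, if b e.1 = b e'.1 ∧ b e.2 = b e'.2 then K else 0 :=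
        Finset.sum_le_sum fun e he => Finset.sum_le_sum fun e' he' => hterm e he e' he'
    _ = ∑ e ∈ E, ((E.filter fun e' => b e.1 = b e'.1 ∧ b e.2 = b e'.2).card : ℝ) * K := by
        refine Finset.sum_congr rfl fun e _ => ?_
        rw [← Finset.sum_filter, Finset.sum_const, nsmul_eq_mul]
    _ ≤ ∑ e ∈ E, W * K := Finset.sum_le_sum fun e he => by
        have := hW e he
        gcongr
    _ = _ := by rw [Finset.sum_const, nsmul_eq_mul]; ring

end SecondMoment

/-! ### Periodic patterns of blocks separated by gaps -/

/-- The time `i` belongs to the pattern of period `3 * q` which consists of the blocks of length `w`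
starting at the times congruent to `-r * q` modulo `3 * q`. -/
def InPattern (q r w i : ℕ) : Prop := (i + r * q) % (3 * q) < w

/-- The number of the period to which the time `i` belongs. -/
def blockIndex (q r i : ℕ) : ℕ := (i + r * q) / (3 * q)

instance (q r w : ℕ) : DecidablePred (InPattern q r w) :=
  fun i => inferInstanceAs (Decidable ((i + r * q) % (3 * q) < w))

lemma blockIndex_mono (q r : ℕ) : Monotone (blockIndex q r) :=
  fun _ _ hij => Nat.div_le_div_right (by omega)

/-- A block has at most `w` elements. -/
lemma card_block_le (q r w k : ℕ) (s : Finset ℕ) :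
    (s.filter fun i => InPattern q r w i ∧ blockIndex q r i = k).card ≤ w := by
  calc _ ≤ (Finset.range w).card := by
        refine Finset.card_le_card_of_injOn (fun i => (i + r * q) % (3 * q)) ?_ ?_
        · intro i hi
          rw [Finset.mem_coe, Finset.mem_filter] at hi
          exact Finset.mem_coe.2 (Finset.mem_range.2 hi.2.1)
        · intro i hi j hj hij
          rw [Finset.mem_coe, Finset.mem_filter] at hi hj
          simp only [blockIndex] at hi hj hij
          have h1 := Nat.div_add_mod (i + r * q) (3 * q)
          have h2 := Nat.div_add_mod (j + r * q) (3 * q)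
          rw [hi.2.2, hij] at h1
          rw [hj.2.2] at h2
          omega
    _ = w := Finset.card_range w

lemma inPattern_iff_mod_three {q r i k : ℕ} (hq : 0 < q) :
    InPattern q r (k * q) i ↔ (i / q + r) % 3 < k := by
  rw [InPattern, mul_comm 3 q, Nat.mod_mul, Nat.add_mul_div_right _ _ hq]
  have h1 : (i + r * q) % q < q := Nat.mod_lt _ hq
  constructor
  · intro h
    by_contra hk
    have : q * k ≤ q * ((i / q + r) % 3) := Nat.mul_le_mul_left _ (by omega)
    rw [mul_comm k q] at h
    omega
  · intro h
    have : q * ((i / q + r) % 3 + 1) ≤ q * k := Nat.mul_le_mul_left _ h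
    rw [mul_comm k q]
    rw [mul_add] at this
    omega

/-- A pair of times lies once more in a pattern with blocks of length `2 * q` than in a pattern with
blocks of length `q`. Indeed, let `a` and `b` be the residue classes modulo `3` of the numbers of
the cells of length `q` that contain the two times: the patterns with blocks of length `2 * q` delete
one class and contain the pair once if `a ≠ b` and `2` times if `a = b`, while those with
blocks of length `q` keep one class and contain the pair `0` times or once respectively. -/
lemma sum_pattern_sub_sum_pattern {G : Type*} [AddCommGroup G] {q : ℕ} (hq : 0 < q) (i j : ℕ)
    (x : G) :
    x = ∑ r ∈ Finset.range 3,
        (if InPattern q r (2 * q) i ∧ InPattern q r (2 * q) j then x else 0)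
      - ∑ r ∈ Finset.range 3,
        (if InPattern q r (1 * q) i ∧ InPattern q r (1 * q) j then x else 0) := by
  simp only [inPattern_iff_mod_three hq, Finset.sum_range_succ, Finset.range_zero,
    Finset.sum_empty]
  have e : ∀ m r : ℕ, (m + r) % 3 = (m % 3 + r) % 3 := fun m r => by omega
  rw [e _ 0, e _ 1, e _ 2, e (j / q) 0, e (j / q) 1, e (j / q) 2]
  have hi : i / q % 3 < 3 := Nat.mod_lt _ (by norm_num)
  have hj : j / q % 3 < 3 := Nat.mod_lt _ (by norm_num)
  generalize i / q % 3 = a at hi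
  generalize j / q % 3 = b at hj
  interval_cases a <;> interval_cases b <;> simp

section Pattern

variable {S H Ω : Type*} [MeasurableSpace S] [NormedAddCommGroup H] [InnerProductSpace ℝ H]
  [CompleteSpace H] [SecondCountableTopology H] [MeasurableSpace H] [BorelSpace H]
  [mΩ : MeasurableSpace Ω] {P : Measure Ω} [IsProbabilityMeasure P] {X : ℤ → Ω → S}
  {h : S × S → H}

lemma sigmaGen_le (hX : ∀ i, Measurable (X i)) (T : Set ℤ) : sigmaGen X T ≤ mΩ :=
  iSup₂_le fun i _ => (hX i).comap_le

lemma measurable_sigmaGen (X : ℤ → Ω → S) {T : Set ℤ} {i : ℤ} (hi : i ∈ T) :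
    Measurable[sigmaGen X T] (X i) :=
  measurable_iff_comap_le.2
    (le_iSup₂ (f := fun i (_ : i ∈ T) => MeasurableSpace.comap (X i) inferInstance) i hi)

/-- The block number `b` of a pattern with blocks of length `w`, the block `0` starting at the time
`c`. Only the first `w` coordinates matter; the sequence is extended periodically, so that no
variable outside the block occurs in it. -/
def blockVar (X : ℤ → Ω → S) (q w : ℕ) (c : ℤ) (b : ℕ) (ω : Ω) (k : ℕ) : S :=
  X (c + 3 * q * b + (k % w : ℕ)) ω

lemma measurable_blockVar (hX : ∀ i, Measurable (X i)) (q w : ℕ) (c : ℤ) (b : ℕ) :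
    Measurable (blockVar X q w c b) :=
  measurable_pi_lambda _ fun _ => hX _

/-- By stationarity, a function of the whole sequence has the same law as the same function of the
shifted sequence. -/
lemma IsStrictlyStationary.map_eq (hstat : IsStrictlyStationary P X)
    {E : Type*} [MeasurableSpace E] {g : (ℤ → S) → E}
    (hg : Measurable g) (k : ℤ) :
    P.map (fun ω => g fun i => X (i + k) ω) = P.map (fun ω => g fun i => X i ω) :=
  ((hstat k).comp hg).map_eq

lemma map_blockVar_eq (hstat : IsStrictlyStationary P X) (q w : ℕ) (c c' : ℤ) (b b' : ℕ) :
    P.map (blockVar X q w c b) = P.map (blockVar X q w c' b') := by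
  have := hstat.map_eq (g := fun (x : ℤ → S) (k : ℕ) => x (c' + 3 * q * b' + (k % w : ℕ)))
    (measurable_pi_lambda _ fun _ => measurable_pi_apply _) (c + 3 * q * b - (c' + 3 * q * b'))
  refine Eq.trans ?_ this
  congr 1
  ext ω k
  simp only [blockVar]
  congr 1
  ring

lemma map_blockVar_pi_eq (hstat : IsStrictlyStationary P X) (q w m : ℕ) (c c' : ℤ) :
    P.map (fun ω (b : Fin m) => blockVar X q w c b ω)
      = P.map (fun ω (b : Fin m) => blockVar X q w c' b ω) := by
  have := hstat.map_eq
    (g := fun (x : ℤ → S) (b : Fin m) (k : ℕ) => x (c' + 3 * q * (b : ℕ) + (k % w : ℕ)))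
    (measurable_pi_lambda _ fun _ => measurable_pi_lambda _ fun _ => measurable_pi_apply _) (c - c')
  refine Eq.trans ?_ this
  congr 1
  ext ω b k
  simp only [blockVar]
  congr 1
  ring

/-- The blocks of a pattern are separated by gaps of length at least `q`, so that their joint law is
close to the product law. -/
lemma map_blockVar_pi_apply_le (hstat : IsStrictlyStationary P X) (hX : ∀ i, Measurable (X i))
    {q w : ℕ} (hq : 0 < q) (hw : 0 < w) (hwq : w ≤ 2 * q) (m : ℕ) (c : ℤ)
    {A : Set (Fin m → ℕ → S)} (hA : MeasurableSet A) :
    P.map (fun ω (b : Fin m) => blockVar X q w c b ω) A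
      ≤ Measure.pi (fun _ => P.map (blockVar X q w 0 0)) A + m * (2 * betaMix P X q) := by
  rw [map_blockVar_pi_eq hstat q w m c (3 * q)]
  have : IsProbabilityMeasure (P.map (blockVar X q w 0 0)) :=
    Measure.isProbabilityMeasure_map (measurable_blockVar hX q w 0 0).aemeasurable
  refine map_pi_apply_le (Z := blockVar X q w (3 * q)) P (P.map (blockVar X q w 0 0))
    (fun b => map_blockVar_eq hstat q w _ _ _ _) (fun b => ?_) m hA
  refine ⟨sigmaGen X (Set.Icc 1 (3 * q * b + 2 * q)),
    sigmaGen X (Set.Ici (3 * q * b + 2 * q + q)), sigmaGen_le hX _, sigmaGen_le hX _,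
    fun c hc => ?_, ?_, ?_⟩
  · refine @measurable_pi_lambda _ _ _ (_) _ _ fun k => measurable_sigmaGen X ?_
    have hk : k % w < w := Nat.mod_lt _ hw
    have hcb : q * (c + 1) ≤ q * b := Nat.mul_le_mul_left q hc
    constructor
    · have : (0 : ℤ) ≤ q * c := by positivity
      push_cast
      lia
    · zify at hcb
      push_cast
      lia
  · refine @measurable_pi_lambda _ _ _ (_) _ _ fun k => measurable_sigmaGen X ?_
    rw [Set.mem_Ici]
    push_cast
    lia
  · refine le_iSup₂_of_le (f := fun (ℓ : ℤ) (_ : 1 ≤ ℓ) =>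
      betaCoeff P (sigmaGen X (Set.Icc 1 ℓ)) (sigmaGen X (Set.Ici (ℓ + q))))
      (3 * q * b + 2 * q) ?_ le_rfl
    have : (0 : ℤ) ≤ q * b := by positivity
    lia

/-- The part of the `U`-statistic carried by the pairs of times of a pattern which satisfy the
condition `R` on their block numbers. Times are counted from `0`: the variable at time `i` is
`X (i + 1)`. -/
noncomputable def patternSum (h : S × S → H) (X : ℤ → Ω → S) (q r w : ℕ) (R : ℕ → ℕ → Prop)
    [DecidableRel R] (n : ℕ) (ω : Ω) : H :=
  ∑ j ∈ Finset.range n, ∑ i ∈ (Finset.range j).filter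
    (fun i => (InPattern q r w i ∧ InPattern q r w j) ∧ R (blockIndex q r i) (blockIndex q r j)),
    h (X (i + 1) ω, X (j + 1) ω)

lemma lintegral_enorm_pair_le (hstat : IsStrictlyStationary P X) (hX : ∀ i, Measurable (X i))
    (hh : Measurable h) {i j : ℕ} (hij : i < j) :
    ∫⁻ ω, ‖h (X (i + 1) ω, X (j + 1) ω)‖ₑ ∂P
      ≤ ⨆ (j : ℤ) (_ : 2 ≤ j), ∫⁻ ω, ‖h (X 1 ω, X j ω)‖ₑ ∂P := by
  refine le_iSup₂_of_le (f := fun (j : ℤ) (_ : 2 ≤ j) => ∫⁻ ω, ‖h (X 1 ω, X j ω)‖ₑ ∂P)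
    ((j : ℤ) + 1 - i) (by lia) (le_of_eq ?_)
  have hg : Measurable fun x : ℤ → S => (x 1, x ((j : ℤ) + 1 - i)) :=
    (measurable_pi_apply _).prodMk (measurable_pi_apply _)
  have := hstat.map_eq hg i
  have e : ∀ f : Ω → S × S, Measurable f →
      ∫⁻ ω, ‖h (f ω)‖ₑ ∂P = ∫⁻ z, ‖h z‖ₑ ∂(P.map f) :=
    fun f hf => (lintegral_map hh.enorm hf).symm
  rw [e _ ((hX _).prodMk (hX _)), e _ ((hX _).prodMk (hX _)), ← this]
  simp only [add_comm (1 : ℤ), sub_add_cancel]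

/-- The contribution of the pairs of times in the same block is controlled in `L¹`. -/
lemma measure_exists_patternSum_eq_gt_le (hstat : IsStrictlyStationary P X)
    (hX : ∀ i, Measurable (X i)) (hh : Measurable h) (q r w N : ℕ) {t : ℝ} (ht : 0 < t) :
    P {ω | ∃ n ≤ N, t < ‖patternSum h X q r w (· = ·) n ω‖}
      ≤ N * w * (⨆ (j : ℤ) (_ : 2 ≤ j), ∫⁻ ω, ‖h (X 1 ω, X j ω)‖ₑ ∂P) / ENNReal.ofReal t := by
  set B := ⨆ (j : ℤ) (_ : 2 ≤ j), ∫⁻ ω, ‖h (X 1 ω, X j ω)‖ₑ ∂P with hB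
  let F : ℕ → Finset ℕ := fun j => (Finset.range j).filter
    (fun i => (InPattern q r w i ∧ InPattern q r w j) ∧ blockIndex q r i = blockIndex q r j)
  have hF : ∀ j, (F j).card ≤ w := fun j =>
    (Finset.card_le_card (Finset.monotone_filter_right _ fun i _ hi => ⟨hi.1.1, hi.2⟩)).trans
      (card_block_le q r w (blockIndex q r j) (Finset.range j))
  have hmeas : ∀ i j : ℕ, Measurable fun ω => ‖h (X (i + 1) ω, X (j + 1) ω)‖ₑ :=
    fun i j => (hh.comp ((hX _).prodMk (hX _))).enorm
  have hsub : {ω | ∃ n ≤ N, t < ‖patternSum h X q r w (· = ·) n ω‖} ⊆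
      {ω | ENNReal.ofReal t ≤
        ∑ j ∈ Finset.range N, ∑ i ∈ F j, ‖h (X (i + 1) ω, X (j + 1) ω)‖ₑ} := by
    rintro ω ⟨n, hn, hω⟩
    calc ENNReal.ofReal t ≤ ENNReal.ofReal ‖patternSum h X q r w (· = ·) n ω‖ :=
          ENNReal.ofReal_le_ofReal hω.le
      _ = ‖patternSum h X q r w (· = ·) n ω‖ₑ := ofReal_norm _
      _ ≤ ∑ j ∈ Finset.range n, ∑ i ∈ F j, ‖h (X (i + 1) ω, X (j + 1) ω)‖ₑ :=
          (enorm_sum_le _ _).trans (Finset.sum_le_sum fun j _ => enorm_sum_le _ _)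
      _ ≤ _ := Finset.sum_le_sum_of_subset (Finset.range_mono hn)
  refine (measure_mono hsub).trans ((meas_ge_le_lintegral_div ?_ (by simpa) (by simp)).trans ?_)
  · exact (Finset.measurable_fun_sum _ fun j _ =>
      Finset.measurable_fun_sum _ fun i _ => hmeas i j).aemeasurable
  · gcongr
    rw [lintegral_finsetSum _ fun j _ => Finset.measurable_fun_sum _ fun i _ => hmeas i j]
    calc _ ≤ ∑ j ∈ Finset.range N, (w : ℝ≥0∞) * B := by
          refine Finset.sum_le_sum fun j _ => ?_
          rw [lintegral_finsetSum _ fun i _ => hmeas i j]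
          calc _ ≤ ∑ i ∈ F j, B := Finset.sum_le_sum fun i hi =>
                lintegral_enorm_pair_le hstat hX hh
                  (Finset.mem_range.1 (Finset.mem_filter.1 hi).1)
            _ = (F j).card * B := by rw [Finset.sum_const, nsmul_eq_mul]
            _ ≤ w * B := by gcongr; exact hF j
      _ = _ := by rw [Finset.sum_const, nsmul_eq_mul, Finset.card_range, mul_assoc]

/-- Under the product law of the blocks, the second moment estimate and the maximal inequality
control the contribution of the pairs of times in distinct blocks. -/
lemma pi_exists_sum_gt_le {ν : Measure S} [IsProbabilityMeasure ν] (hd : IsDegenerate ν h)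
    {μ : Measure (ℕ → S)} [IsProbabilityMeasure μ] (hμ : ∀ k, μ.map (fun z => z k) = ν)
    (q r w L M : ℕ) {b : ℕ → Fin M} (hb : ∀ i < 2 ^ L, (b i : ℕ) = blockIndex q r i)
    {t : ℝ} (ht : 0 < t) :
    Measure.pi (fun _ => μ) {x : Fin M → ℕ → S | ∃ n ≤ 2 ^ L, t < ‖∑ j ∈ Finset.range n,
        ∑ i ∈ (Finset.range j).filter
          (fun i => (InPattern q r w i ∧ InPattern q r w j) ∧ b i ≠ b j),
        pairKernel h (fun i z => z ((i + r * q) % (3 * q))) b (i, j) x‖}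
      ≤ ENNReal.ofReal ((L + 1) ^ 2 *
        ((∫ z, ‖h z‖ ^ 2 ∂(ν.prod ν)) * (2 ^ L * w ^ 2) * 2 ^ L) / t ^ 2) := by
  set φ : ℕ → (ℕ → S) → S := fun i z => z ((i + r * q) % (3 * q)) with hφdef
  have hφ : ∀ i, Measurable (φ i) := fun i => measurable_pi_apply _
  have hφν : ∀ i, μ.map (φ i) = ν := fun i => hμ _
  set F : ℕ → Finset ℕ := fun j => (Finset.range j).filter
    (fun i => (InPattern q r w i ∧ InPattern q r w j) ∧ b i ≠ b j) with hF
  refine measure_exists_partialSum_gt_le (D := fun j x => ∑ i ∈ F j, pairKernel h φ b (i, j) x)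
    (fun j => memLp_finsetSum _ fun i hi => memLp_pairKernel hd hφ hφν
      (Finset.mem_filter.1 hi).2.2) L (fun a c hac hc => ?_) ht
  let E : Finset (ℕ × ℕ) := (Finset.range (2 ^ L) ×ˢ Finset.Ico a c).filter fun e =>
    e.1 < e.2 ∧ (InPattern q r w e.1 ∧ InPattern q r w e.2) ∧ b e.1 ≠ b e.2
  have hmem : ∀ e, e ∈ E ↔ e.2 ∈ Finset.Ico a c ∧ e.1 ∈ F e.2 := by
    intro e
    simp only [E, F, Finset.mem_filter, Finset.mem_product, Finset.mem_range, Finset.mem_Ico]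
    constructor
    · rintro ⟨⟨_, h2⟩, h3, h4⟩
      exact ⟨h2, h3, h4⟩
    · rintro ⟨h2, h3, h4⟩
      exact ⟨⟨by omega, h2⟩, h3, h4⟩
  have hElt : ∀ e ∈ E, e.1 < 2 ^ L ∧ e.2 < 2 ^ L ∧ e.1 < e.2 ∧ InPattern q r w e.1 ∧
      InPattern q r w e.2 ∧ b e.1 ≠ b e.2 := by
    intro e he
    simp only [E, Finset.mem_filter, Finset.mem_product, Finset.mem_range, Finset.mem_Ico] at he
    exact ⟨he.1.1, by omega, he.2.1, he.2.2.1.1, he.2.2.1.2, he.2.2.2⟩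
  have hsum : ∀ x, ∑ j ∈ Finset.Ico a c, ∑ i ∈ F j, pairKernel h φ b (i, j) x
      = ∑ e ∈ E, pairKernel h φ b e x := fun x =>
    (Finset.sum_finset_product_right' E (Finset.Ico a c) F hmem
      (f := fun i j => pairKernel h φ b (i, j) x)).symm
  simp_rw [hsum]
  have hEb : ∀ e ∈ E, b e.1 < b e.2 := by
    intro e he
    obtain ⟨h1, h2, h3, _, _, h6⟩ := hElt e he
    refine lt_of_le_of_ne ?_ h6
    rw [Fin.le_def, hb _ h1, hb _ h2]
    exact blockIndex_mono q r h3.le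
  have hW : ∀ e ∈ E,
      ((E.filter fun e' => b e.1 = b e'.1 ∧ b e.2 = b e'.2).card : ℝ) ≤ (w : ℝ) ^ 2 := by
    intro e he
    let G : ℕ → Finset ℕ := fun k => (Finset.range (2 ^ L)).filter
      fun i => InPattern q r w i ∧ blockIndex q r i = k
    have : (E.filter fun e' => b e.1 = b e'.1 ∧ b e.2 = b e'.2) ⊆ G (b e.1) ×ˢ G (b e.2) := by
      intro e' he'
      obtain ⟨he'E, h1, h2⟩ := Finset.mem_filter.1 he'
      obtain ⟨h3, h4, _, h5, h6, _⟩ := hElt e' he'E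
      simp only [G, Finset.mem_product, Finset.mem_filter, Finset.mem_range]
      exact ⟨⟨h3, h5, by rw [h1, hb _ h3]⟩, ⟨h4, h6, by rw [h2, hb _ h4]⟩⟩
    have hcard := Finset.card_le_card this
    rw [Finset.card_product] at hcard
    have h7 : (E.filter fun e' => b e.1 = b e'.1 ∧ b e.2 = b e'.2).card ≤ w ^ 2 := by
      rw [pow_two]
      exact hcard.trans (Nat.mul_le_mul (card_block_le q r w _ _) (card_block_le q r w _ _))
    exact_mod_cast h7
  refine (integral_norm_sq_sum_le hd hφ hφν E hEb hW).trans ?_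
  have hcardE : (E.card : ℝ) ≤ 2 ^ L * (c - a : ℝ) := by
    have h1 := Finset.card_filter_le (Finset.range (2 ^ L) ×ˢ Finset.Ico a c) fun e =>
      e.1 < e.2 ∧ (InPattern q r w e.1 ∧ InPattern q r w e.2) ∧ b e.1 ≠ b e.2
    rw [Finset.card_product, Finset.card_range, Nat.card_Ico] at h1
    have h2 : (E.card : ℝ) ≤ ((2 ^ L * (c - a) : ℕ) : ℝ) := by exact_mod_cast h1
    rwa [Nat.cast_mul, Nat.cast_sub hac, Nat.cast_pow, Nat.cast_ofNat] at h2
  have hK : 0 ≤ ∫ z, ‖h z‖ ^ 2 ∂(ν.prod ν) := integral_nonneg fun _ => by positivity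
  calc _ ≤ (∫ z, ‖h z‖ ^ 2 ∂(ν.prod ν)) * (2 ^ L * (c - a : ℝ) * w ^ 2) := by gcongr
    _ = _ := by ring

/-- The contribution of the pairs of times in distinct blocks is controlled by comparison with
independent blocks. -/
lemma measure_exists_patternSum_ne_gt_le (hstat : IsStrictlyStationary P X)
    (hX : ∀ i, Measurable (X i)) (hd : IsDegenerate (P.map (X 1)) h) {q r w : ℕ} (hq : 0 < q)
    (hr : r < 3) (hw : 0 < w) (hwq : w ≤ 2 * q) (L : ℕ) {t : ℝ} (ht : 0 < t) :
    P {ω | ∃ n ≤ 2 ^ L, t < ‖patternSum h X q r w (· ≠ ·) n ω‖}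
      ≤ ENNReal.ofReal ((L + 1) ^ 2 *
        ((∫ z, ‖h z‖ ^ 2 ∂((P.map (X 1)).prod (P.map (X 1)))) * (2 ^ L * w ^ 2) * 2 ^ L) / t ^ 2)
        + (2 ^ L / (3 * q) + 2 : ℕ) * (2 * betaMix P X q) := by
  set M := 2 ^ L / (3 * q) + 2 with hM
  have : NeZero M := ⟨Nat.succ_ne_zero _⟩
  set c : ℤ := 1 - r * q with hc
  let b : ℕ → Fin M := fun i => Fin.ofNat M (blockIndex q r i)
  have hb : ∀ i < 2 ^ L, (b i : ℕ) = blockIndex q r i := by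
    intro i hi
    refine Nat.mod_eq_of_lt ?_
    have h1 : blockIndex q r i ≤ (2 ^ L + 3 * q) / (3 * q) :=
      Nat.div_le_div_right (by have : r * q ≤ 3 * q := Nat.mul_le_mul_right q hr.le; omega)
    rw [Nat.add_div_right _ (by omega)] at h1
    omega
  set μ := P.map (blockVar X q w 0 0) with hμ
  have hμp : IsProbabilityMeasure μ :=
    Measure.isProbabilityMeasure_map (measurable_blockVar hX q w 0 0).aemeasurable
  have hνp : IsProbabilityMeasure (P.map (X 1)) :=
    Measure.isProbabilityMeasure_map (hX 1).aemeasurable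
  have hμk : ∀ k, μ.map (fun z => z k) = P.map (X 1) := by
    intro k
    rw [hμ, Measure.map_map (measurable_pi_apply k) (measurable_blockVar hX q w 0 0)]
    have := hstat.map_eq (g := fun x : ℤ → S => x 1) (measurable_pi_apply _) ((k % w : ℕ) - 1)
    rw [← this]
    congr 1
    ext ω
    simp only [Function.comp, blockVar]
    congr 1
    push_cast
    ring
  set φ : ℕ → (ℕ → S) → S := fun i z => z ((i + r * q) % (3 * q)) with hφdef
  set A : Set (Fin M → ℕ → S) := {x | ∃ n ≤ 2 ^ L, t < ‖∑ j ∈ Finset.range n,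
        ∑ i ∈ (Finset.range j).filter
          (fun i => (InPattern q r w i ∧ InPattern q r w j) ∧ b i ≠ b j),
        pairKernel h φ b (i, j) x‖} with hAdef
  have hA : MeasurableSet A := by
    have : A = ⋃ n ∈ Set.Iic (2 ^ L), {x | t < ‖∑ j ∈ Finset.range n,
        ∑ i ∈ (Finset.range j).filter
          (fun i => (InPattern q r w i ∧ InPattern q r w j) ∧ b i ≠ b j),
        pairKernel h φ b (i, j) x‖} := by
      ext x
      simp [hAdef]
    rw [this]
    refine MeasurableSet.biUnion (Set.to_countable _) fun n _ => ?_
    exact measurableSet_lt measurable_const (Finset.measurable_fun_sum _ fun j _ =>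
      Finset.measurable_fun_sum _ fun i _ =>
        measurable_pairKernel hd (fun _ => measurable_pi_apply _) _).norm
  have hZ : Measurable fun ω (b : Fin M) => blockVar X q w c b ω :=
    measurable_pi_lambda _ fun b => measurable_blockVar hX q w c b
  have hset : {ω | ∃ n ≤ 2 ^ L, t < ‖patternSum h X q r w (· ≠ ·) n ω‖}
      = (fun ω (b : Fin M) => blockVar X q w c b ω) ⁻¹' A := by
    ext ω
    simp only [hAdef, Set.mem_preimage, Set.mem_ofPred_eq]
    refine exists_congr fun n => and_congr_right fun hn => ?_
    -- the variable at a time `i` of the pattern is read off from the block of `i`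
    have hval : ∀ i < 2 ^ L, InPattern q r w i →
        φ i (blockVar X q w c (b i) ω) = X (i + 1) ω := by
      intro i hi hpat
      simp only [hφdef, blockVar, hb i hi]
      rw [Nat.mod_eq_of_lt hpat]
      congr 1
      have h1 := Nat.div_add_mod (i + r * q) (3 * q)
      zify at h1
      simp only [blockIndex, hc]
      push_cast
      linarith
    have hsum : patternSum h X q r w (· ≠ ·) n ω = ∑ j ∈ Finset.range n,
        ∑ i ∈ (Finset.range j).filter
          (fun i => (InPattern q r w i ∧ InPattern q r w j) ∧ b i ≠ b j),
        pairKernel h φ b (i, j) fun b : Fin M => blockVar X q w c b ω := by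
      refine Finset.sum_congr rfl fun j hj => ?_
      have hj' : j < 2 ^ L := (Finset.mem_range.1 hj).trans_le hn
      have hfil : (Finset.range j).filter (fun i => (InPattern q r w i ∧ InPattern q r w j) ∧
          blockIndex q r i ≠ blockIndex q r j) = (Finset.range j).filter
          (fun i => (InPattern q r w i ∧ InPattern q r w j) ∧ b i ≠ b j) := by
        refine Finset.filter_congr fun i hi => ?_
        rw [ne_eq, ne_eq, Fin.ext_iff, hb i ((Finset.mem_range.1 hi).trans hj'), hb j hj']
      rw [hfil]
      refine Finset.sum_congr rfl fun i hi => ?_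
      obtain ⟨hi1, ⟨hi2, hi3⟩, _⟩ := Finset.mem_filter.1 hi
      rw [pairKernel, hval i ((Finset.mem_range.1 hi1).trans hj') hi2, hval j hj' hi3]
    rw [hsum]
  rw [hset, ← Measure.map_apply hZ hA]
  refine (map_blockVar_pi_apply_le hstat hX hq hw hwq M c hA).trans ?_
  gcongr
  exact pi_exists_sum_gt_le hd hμk q r w L M hb ht

end Pattern

/-! ### A maximal inequality for the `U`-statistic -/

section Maximal

variable {S H Ω : Type*} [MeasurableSpace S] [NormedAddCommGroup H] [InnerProductSpace ℝ H]
  [CompleteSpace H] [SecondCountableTopology H] [MeasurableSpace H] [BorelSpace H]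
  [mΩ : MeasurableSpace Ω] {P : Measure Ω} [IsProbabilityMeasure P] {X : ℤ → Ω → S}
  {h : S × S → H}

lemma uStat_eq_sum_range (h : S × S → H) (X : ℤ → Ω → S) (n : ℕ) (ω : Ω) :
    uStat h X n ω = ∑ j ∈ Finset.range n, ∑ i ∈ Finset.range j,
      h (X (i + 1) ω, X (j + 1) ω) := by
  rw [← Finset.sum_finset_product_right'
    ((Finset.range n ×ˢ Finset.range n).filter fun e => e.1 < e.2) (Finset.range n)
    (fun j => Finset.range j) (f := fun i j : ℕ => h (X (i + 1) ω, X (j + 1) ω))]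
  · rw [uStat]
    refine Finset.sum_nbij' (fun e => ((e.1 - 1).toNat, (e.2 - 1).toNat))
      (fun e => ((e.1 : ℤ) + 1, (e.2 : ℤ) + 1)) ?_ ?_ ?_ ?_ ?_
    · intro e he
      simp only [Finset.mem_filter, Finset.mem_product, Finset.mem_Icc, Finset.mem_range] at he ⊢
      omega
    · intro e he
      simp only [Finset.mem_filter, Finset.mem_product, Finset.mem_Icc, Finset.mem_range] at he ⊢
      omega
    · intro e he
      simp only [Finset.mem_filter, Finset.mem_product, Finset.mem_Icc] at he
      ext <;> simp only <;> omega
    · intro e he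
      ext <;> simp
    · intro e he
      simp only [Finset.mem_filter, Finset.mem_product, Finset.mem_Icc] at he
      have h1 : (((e.1 - 1).toNat : ℤ) + 1) = e.1 := by omega
      have h2 : (((e.2 - 1).toNat : ℤ) + 1) = e.2 := by omega
      simp only [h1, h2]
  · intro e
    simp only [Finset.mem_filter, Finset.mem_product, Finset.mem_range]
    omega

lemma patternSum_eq_add_ne (h : S × S → H) (X : ℤ → Ω → S) (q r w n : ℕ) (ω : Ω) :
    patternSum h X q r w (· = ·) n ω + patternSum h X q r w (· ≠ ·) n ω
      = ∑ j ∈ Finset.range n, ∑ i ∈ Finset.range j,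
        if InPattern q r w i ∧ InPattern q r w j then h (X (i + 1) ω, X (j + 1) ω) else 0 := by
  rw [patternSum, patternSum, ← Finset.sum_add_distrib]
  refine Finset.sum_congr rfl fun j _ => ?_
  rw [Finset.sum_filter, Finset.sum_filter, ← Finset.sum_add_distrib]
  refine Finset.sum_congr rfl fun i _ => ?_
  by_cases h1 : InPattern q r w i ∧ InPattern q r w j <;>
    by_cases h2 : blockIndex q r i = blockIndex q r j <;> simp [h1, h2]

/-- The `U`-statistic as a signed combination of six pattern sums. -/
lemma uStat_eq_sum_pattern (h : S × S → H) (X : ℤ → Ω → S) {q : ℕ} (hq : 0 < q) (n : ℕ) (ω : Ω) :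
    uStat h X n ω
      = ∑ r ∈ Finset.range 3, (patternSum h X q r (2 * q) (· = ·) n ω
          + patternSum h X q r (2 * q) (· ≠ ·) n ω)
        - ∑ r ∈ Finset.range 3, (patternSum h X q r (1 * q) (· = ·) n ω
          + patternSum h X q r (1 * q) (· ≠ ·) n ω) := by
  simp_rw [patternSum_eq_add_ne]
  have hcomm : ∀ F : ℕ → ℕ → ℕ → H, ∑ r ∈ Finset.range 3, ∑ j ∈ Finset.range n,
      ∑ i ∈ Finset.range j, F r i j
      = ∑ j ∈ Finset.range n, ∑ i ∈ Finset.range j, ∑ r ∈ Finset.range 3, F r i j := by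
    intro F
    rw [Finset.sum_comm]
    exact Finset.sum_congr rfl fun j _ => Finset.sum_comm
  rw [hcomm, hcomm, ← Finset.sum_sub_distrib, uStat_eq_sum_range]
  refine Finset.sum_congr rfl fun j _ => ?_
  rw [← Finset.sum_sub_distrib]
  exact Finset.sum_congr rfl fun i _ => sum_pattern_sub_sum_pattern hq i j _

/-- The maximal inequality on which the strong law rests; the length `q` of the gaps is free. -/
lemma measure_exists_uStat_gt_le (hstat : IsStrictlyStationary P X)
    (hX : ∀ i, Measurable (X i)) (hd : IsDegenerate (P.map (X 1)) h) {q : ℕ} (hq : 0 < q)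
    (L : ℕ) {t : ℝ} (ht : 0 < t) :
    P {ω | ∃ n ≤ 2 ^ L, 12 * t < ‖uStat h X n ω‖}
      ≤ 6 * (ENNReal.ofReal ((L + 1) ^ 2 *
          ((∫ z, ‖h z‖ ^ 2 ∂((P.map (X 1)).prod (P.map (X 1)))) * (2 ^ L * (2 * q) ^ 2) * 2 ^ L)
            / t ^ 2)
        + (2 ^ L / (3 * q) + 2 : ℕ) * (2 * betaMix P X q)
        + 2 ^ L * (2 * q) * (⨆ (j : ℤ) (_ : 2 ≤ j), ∫⁻ ω, ‖h (X 1 ω, X j ω)‖ₑ ∂P)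
            / ENNReal.ofReal t) := by
  set K := ∫ z, ‖h z‖ ^ 2 ∂((P.map (X 1)).prod (P.map (X 1))) with hK
  have hK0 : 0 ≤ K := integral_nonneg fun _ => by positivity
  set B := ⨆ (j : ℤ) (_ : 2 ≤ j), ∫⁻ ω, ‖h (X 1 ω, X j ω)‖ₑ ∂P
  set c₁ : ℝ≥0∞ := ENNReal.ofReal ((L + 1) ^ 2 * (K * (2 ^ L * (2 * q) ^ 2) * 2 ^ L) / t ^ 2)
        + (2 ^ L / (3 * q) + 2 : ℕ) * (2 * betaMix P X q) with hc₁
  set c₂ : ℝ≥0∞ := 2 ^ L * (2 * q) * B / ENNReal.ofReal t with hc₂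
  let A : ℕ → ℕ → Set Ω := fun r w =>
    {ω | ∃ n ≤ 2 ^ L, t < ‖patternSum h X q r w (· = ·) n ω‖} ∪
      {ω | ∃ n ≤ 2 ^ L, t < ‖patternSum h X q r w (· ≠ ·) n ω‖}
  have hA : ∀ r < 3, ∀ w, 0 < w → w ≤ 2 * q → P (A r w) ≤ c₁ + c₂ := by
    intro r hr w hw hwq
    have hwq' : (w : ℝ) ≤ 2 * q := by exact_mod_cast hwq
    have hwq'' : (w : ℝ≥0∞) ≤ 2 * q := by exact_mod_cast hwq
    refine (measure_union_le _ _).trans ?_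
    rw [add_comm c₁]
    refine add_le_add ?_ ?_
    · refine (measure_exists_patternSum_eq_gt_le hstat hX hd.measurable q r w (2 ^ L) ht).trans ?_
      rw [hc₂]
      push_cast
      gcongr
    · refine (measure_exists_patternSum_ne_gt_le hstat hX hd hq hr hw hwq L ht).trans ?_
      rw [hc₁]
      gcongr
  have hsub : {ω | ∃ n ≤ 2 ^ L, 12 * t < ‖uStat h X n ω‖}
      ⊆ ⋃ r ∈ Finset.range 3, (A r (2 * q) ∪ A r (1 * q)) := by
    rintro ω ⟨n, hn, hω⟩
    by_contra hcon
    simp only [A, Set.mem_iUnion, Set.mem_union, Set.mem_ofPred_eq, not_exists, not_or, not_and,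
      not_lt] at hcon
    have hle : ∀ r ∈ Finset.range 3, ∀ w, w = 2 * q ∨ w = 1 * q →
        ‖patternSum h X q r w (· = ·) n ω + patternSum h X q r w (· ≠ ·) n ω‖ ≤ 2 * t := by
      intro r hr w hw
      obtain ⟨⟨h1, h2⟩, h3, h4⟩ := hcon r hr
      rcases hw with rfl | rfl
      · linarith [norm_add_le (patternSum h X q r (2 * q) (· = ·) n ω)
          (patternSum h X q r (2 * q) (· ≠ ·) n ω), h1 n hn, h2 n hn]
      · linarith [norm_add_le (patternSum h X q r (1 * q) (· = ·) n ω)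
          (patternSum h X q r (1 * q) (· ≠ ·) n ω), h3 n hn, h4 n hn]
    have hsum : ∀ w, w = 2 * q ∨ w = 1 * q → ‖∑ r ∈ Finset.range 3,
        (patternSum h X q r w (· = ·) n ω + patternSum h X q r w (· ≠ ·) n ω)‖ ≤ 6 * t := by
      intro w hw
      refine (norm_sum_le _ _).trans ((Finset.sum_le_sum fun r hr => hle r hr w hw).trans ?_)
      rw [Finset.sum_const, Finset.card_range, nsmul_eq_mul]
      push_cast
      linarith
    rw [uStat_eq_sum_pattern h X hq] at hω
    linarith [norm_sub_le (∑ r ∈ Finset.range 3, (patternSum h X q r (2 * q) (· = ·) n ω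
          + patternSum h X q r (2 * q) (· ≠ ·) n ω))
        (∑ r ∈ Finset.range 3, (patternSum h X q r (1 * q) (· = ·) n ω
          + patternSum h X q r (1 * q) (· ≠ ·) n ω)), hsum _ (Or.inl rfl), hsum _ (Or.inr rfl)]
  refine (measure_mono hsub).trans ((measure_biUnion_finset_le _ _).trans ?_)
  calc _ ≤ ∑ r ∈ Finset.range 3, ((c₁ + c₂) + (c₁ + c₂)) := by
        refine Finset.sum_le_sum fun r hr => (measure_union_le _ _).trans (add_le_add ?_ ?_)
        · exact hA r (Finset.mem_range.1 hr) _ (by omega) le_rfl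
        · exact hA r (Finset.mem_range.1 hr) _ (by omega) (by omega)
    _ = 6 * (c₁ + c₂) := by
        rw [Finset.sum_const, Finset.card_range, nsmul_eq_mul]
        push_cast
        ring

end Maximal

/-! ### Degeneracy of the kernel and decay of the mixing coefficients -/

/-- The vanishing of the conditional expectation, expressed through the law of the variables. -/
lemma ae_integral_eq_zero_of_condExp {S H Θ : Type*} [MeasurableSpace S] [NormedAddCommGroup H]
    [NormedSpace ℝ H] [CompleteSpace H] [MeasurableSpace Θ] {π : Measure Θ}
    [IsProbabilityMeasure π] {ν : Measure S} [IsProbabilityMeasure ν] {Y Y' : Θ → S}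
    (hY : Measurable Y) (hY' : Measurable Y') {h : S × S → H}
    (hlaw : π.map (fun x => (Y x, Y' x)) = ν.prod ν) (hint : Integrable h (ν.prod ν))
    (hcond : π[fun x => h (Y x, Y' x) | MeasurableSpace.comap Y inferInstance] =ᵐ[π] 0) :
    ∀ᵐ x ∂ν, ∫ y, h (x, y) ∂ν = 0 := by
  have hYY' : Measurable fun x => (Y x, Y' x) := hY.prodMk hY'
  have hint' : Integrable (fun x => h (Y x, Y' x)) π := by
    rw [← hlaw] at hint
    exact hint.comp_measurable hYY'
  refine Integrable.ae_eq_zero_of_forall_setIntegral_eq_zero hint.integral_prod_left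
    fun B hB _ => ?_
  have h1 : ∫ x in B, ∫ y, h (x, y) ∂ν ∂ν = ∫ z in B ×ˢ Set.univ, h z ∂(ν.prod ν) := by
    rw [setIntegral_prod _ hint.integrableOn]
    simp
  rw [h1, ← hlaw, setIntegral_map (hB.prod MeasurableSet.univ) (hlaw ▸ hint.1)
    hYY'.aemeasurable]
  have h2 : (fun x => (Y x, Y' x)) ⁻¹' (B ×ˢ Set.univ) = Y ⁻¹' B := by ext; simp
  rw [h2, ← setIntegral_condExp hY.comap_le hint' ⟨B, hB, rfl⟩,
    setIntegral_congr_ae (g := fun _ => (0 : H)) (hY hB) (hcond.mono fun x hx _ => hx)]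
  simp

/-- The hypotheses of the strong law on an independent copy say that the kernel is degenerate. A
moment of order at least `2` is needed for the square integrability. -/
lemma isDegenerate_of_condExp {S H Θ : Type*} [MeasurableSpace S] [NormedAddCommGroup H]
    [InnerProductSpace ℝ H] [CompleteSpace H] [SecondCountableTopology H] [MeasurableSpace H]
    [BorelSpace H] [MeasurableSpace Θ] {π : Measure Θ} [IsProbabilityMeasure π] {ν : Measure S}
    [IsProbabilityMeasure ν] {Y Y' : Θ → S} (hY : Measurable Y) (hY' : Measurable Y')
    (hYν : π.map Y = ν) (hY'ν : π.map Y' = ν) (hind : IndepFun Y Y' π) {h : S × S → H}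
    (hh : Measurable h)
    (hcond : π[fun x => h (Y x, Y' x) | MeasurableSpace.comap Y inferInstance] =ᵐ[π] 0)
    (hcond' : π[fun x => h (Y x, Y' x) | MeasurableSpace.comap Y' inferInstance] =ᵐ[π] 0)
    {s : ℝ} (hs : 2 ≤ s) (hmom : ∫⁻ x, ‖h (Y x, Y' x)‖ₑ ^ s ∂π < ∞) :
    IsDegenerate ν h := by
  have hlaw : π.map (fun x => (Y x, Y' x)) = ν.prod ν := by
    rw [(indepFun_iff_map_prod_eq_prod_map_map hY.aemeasurable hY'.aemeasurable).1 hind, hYν, hY'ν]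
  have hlaw' : π.map (fun x => (Y' x, Y x)) = ν.prod ν := by
    rw [(indepFun_iff_map_prod_eq_prod_map_map hY'.aemeasurable hY.aemeasurable).1 hind.symm,
      hYν, hY'ν]
  have hs0 : 0 < s := by linarith
  have hL : MemLp (fun x => h (Y x, Y' x)) (ENNReal.ofReal s) π := by
    refine ⟨(hh.comp (hY.prodMk hY')).aestronglyMeasurable, ?_⟩
    rw [eLpNorm_lt_top_iff_lintegral_rpow_enorm_lt_top (by simpa using hs0) (by simp),
      ENNReal.toReal_ofReal hs0.le]
    exact hmom
  have hL2 : MemLp h 2 (ν.prod ν) := by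
    rw [← hlaw, memLp_map_measure_iff hh.aestronglyMeasurable (hY.prodMk hY').aemeasurable]
    refine hL.mono_exponent ?_
    rw [← ENNReal.ofReal_ofNat]
    exact ENNReal.ofReal_le_ofReal hs
  have hint : Integrable h (ν.prod ν) := hL2.integrable (by norm_num)
  exact ⟨hh, hL2, ae_integral_eq_zero_of_condExp hY hY' hlaw hint hcond,
    ae_integral_eq_zero_of_condExp (h := h ∘ Prod.swap) hY' hY hlaw' hint.swap hcond'⟩

section Mixing

variable {S Ω : Type*} [MeasurableSpace S]

lemma betaCoeff_mono_right {𝒜 ℬ ℬ' : MeasurableSpace Ω} [MeasurableSpace Ω] (P : Measure Ω)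
    (hℬ : ℬ ≤ ℬ') : betaCoeff P 𝒜 ℬ ≤ betaCoeff P 𝒜 ℬ' := by
  rw [betaCoeff, betaCoeff]
  gcongr with I J A B hA
  exact iSup_mono' fun hB => ⟨⟨fun i => hℬ _ (hB.measurable i), hB.disjoint, hB.cover⟩, le_rfl⟩

lemma betaMix_antitone [MeasurableSpace Ω] (P : Measure Ω) (X : ℤ → Ω → S) :
    Antitone (betaMix P X) := by
  intro k l hkl
  refine iSup₂_mono fun ℓ _ => betaCoeff_mono_right P ?_
  refine biSup_mono fun i hi => ?_
  rw [Set.mem_Ici] at hi ⊢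
  have : (k : ℤ) ≤ l := by exact_mod_cast hkl
  linarith

/-- Since the mixing coefficients are nonincreasing, a summability condition gives a rate. -/
lemma exists_betaMix_le [MeasurableSpace Ω] (P : Measure Ω) (X : ℤ → Ω → S) {s : ℝ} (hs : 0 ≤ s)
    (hmix : ∑' k : ℕ+, ENNReal.ofReal (((k : ℕ) : ℝ) ^ s) * betaMix P X (k : ℕ) < ∞) :
    ∃ C : ℝ, 0 ≤ C ∧ ∀ r : ℕ, 0 < r →
      betaMix P X (2 * r) ≤ ENNReal.ofReal (C * (r : ℝ) ^ (-(s + 1))) := by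
  set T := ∑' k : ℕ+, ENNReal.ofReal (((k : ℕ) : ℝ) ^ s) * betaMix P X (k : ℕ) with hT
  refine ⟨T.toReal, ENNReal.toReal_nonneg, fun r hr => ?_⟩
  have hr' : (0 : ℝ) < r := by exact_mod_cast hr
  let ρ : ℕ+ := ⟨r, hr⟩
  have h1 : ENNReal.ofReal ((r : ℝ) ^ (s + 1)) * betaMix P X (2 * r) ≤ T := by
    calc _ = ∑ _k ∈ Finset.Ioc ρ (2 * ρ), ENNReal.ofReal ((r : ℝ) ^ s) * betaMix P X (2 * r) := by
          rw [Finset.sum_const, PNat.card_Ioc, nsmul_eq_mul, ← mul_assoc]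
          congr 1
          have : ((2 * ρ : ℕ+) : ℕ) - (ρ : ℕ) = r := by
            have h1 : ((2 * ρ : ℕ+) : ℕ) = 2 * r := rfl
            have h2 : (ρ : ℕ) = r := rfl
            omega
          rw [this, Real.rpow_add_one hr'.ne', mul_comm, ENNReal.ofReal_mul hr'.le,
            ENNReal.ofReal_natCast]
      _ ≤ ∑ k ∈ Finset.Ioc ρ (2 * ρ),
          ENNReal.ofReal (((k : ℕ) : ℝ) ^ s) * betaMix P X (k : ℕ) := by
          refine Finset.sum_le_sum fun k hk => ?_
          obtain ⟨hk1, hk2⟩ := Finset.mem_Ioc.1 hk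
          have hk1' : r ≤ (k : ℕ) := (PNat.coe_lt_coe _ _).2 hk1 |>.le
          have hk2' : (k : ℕ) ≤ 2 * r := (PNat.coe_le_coe _ _).2 hk2
          gcongr
          exact betaMix_antitone P X hk2'
      _ ≤ T := ENNReal.sum_le_tsum _
  have h2 : (0 : ℝ) < (r : ℝ) ^ (s + 1) := by positivity
  rw [Real.rpow_neg hr'.le, ENNReal.ofReal_mul ENNReal.toReal_nonneg, ENNReal.ofReal_toReal hmix.ne,
    ENNReal.ofReal_inv_of_pos h2, ← div_eq_mul_inv,
    ENNReal.le_div_iff_mul_le (Or.inl (by simpa using h2)) (Or.inl (by simp)), mul_comm]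
  exact h1

end Mixing

/-! ### Summability of the tail probabilities -/

lemma summable_succ_sq_mul_geometric {ρ : ℝ} (h0 : 0 < ρ) (h1 : ρ < 1) :
    Summable fun L : ℕ => ((L : ℝ) + 1) ^ 2 * ρ ^ L := by
  have h := summable_pow_mul_geometric_of_norm_lt_one 2
    (show ‖ρ‖ < 1 by rwa [Real.norm_of_nonneg h0.le])
  have h2 := ((summable_nat_add_iff 1).2 h).mul_right ρ⁻¹
  refine h2.congr fun L => ?_
  push_cast
  rw [pow_succ ρ L, mul_assoc, mul_assoc, mul_inv_cancel₀ h0.ne', mul_one]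

/-- The exponents of the tail estimate are negative for the exponent `α = 1 - p / 2` of the block
length: the first one governs both the pairs in the same block and those in distinct blocks, the
second one the comparison with independent blocks. -/
lemma exponent_bounds {p η : ℝ} (hp1 : 1 < p) (hp2 : p < 2) (hη : 0 < η) :
    1 + (1 - p / 2) - 2 / p < 0 ∧
      1 - (1 - p / 2) * (2 * (p - 1) / (2 - p) + η + 2) < 0 := by
  have hp0 : 0 < p := by linarith
  have h2p : 0 < 2 - p := by linarith
  constructor
  · have : 1 + (1 - p / 2) - 2 / p = -((2 - p) ^ 2 / (2 * p)) := by
      field_simp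
      ring
    rw [this]
    have : 0 < (2 - p) ^ 2 / (2 * p) := by positivity
    linarith
  · have : 1 - (1 - p / 2) * (2 * (p - 1) / (2 - p) + η + 2) = -((2 - p) / 2 * η) := by
      field_simp
      ring
    rw [this]
    have : 0 < (2 - p) / 2 * η := by positivity
    linarith

/-- The bounds of the maximal inequality, with gaps of length `2 * ⌈2 ^ (α L)⌉` and thresholds of
order `2 ^ (θ L)`, are summable over the dyadic scales `L`. -/
lemma tsum_tail_lt_top {α θ s K B C ε : ℝ} (hα0 : 0 ≤ α) (hα1 : α ≤ 1) (hs : 0 ≤ s)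
    (hθ : 1 + α - θ < 0) (hαs : 1 - α * (s + 2) < 0) (hK : 0 ≤ K) (hB : 0 ≤ B) (hC : 0 ≤ C)
    (hε : 0 < ε) {β : ℕ → ℝ≥0∞}
    (hβ : ∀ r : ℕ, 0 < r → β (2 * r) ≤ ENNReal.ofReal (C * (r : ℝ) ^ (-(s + 1))))
    (q : ℕ → ℕ) (hq : ∀ L, q L = 2 * ⌈(2 : ℝ) ^ (α * L)⌉₊) :
    ∑' L : ℕ, 6 * (ENNReal.ofReal (((L : ℝ) + 1) ^ 2 *
          (K * (2 ^ L * (2 * (q L : ℝ)) ^ 2) * 2 ^ L) / (ε * (2 : ℝ) ^ (θ * L)) ^ 2)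
        + (2 ^ L / (3 * q L) + 2 : ℕ) * (2 * β (q L))
        + 2 ^ L * (2 * (q L : ℝ≥0∞)) * ENNReal.ofReal B
            / ENNReal.ofReal (ε * (2 : ℝ) ^ (θ * L))) < ∞ := by
  set ρ₁ : ℝ := 2 ^ (1 + α - θ) with hρ₁
  set ρ₂ : ℝ := 2 ^ (1 - α * (s + 2)) with hρ₂
  have hρ₁0 : 0 < ρ₁ := by positivity
  have hρ₂0 : 0 < ρ₂ := by positivity
  have hρ₁1 : ρ₁ < 1 := Real.rpow_lt_one_of_one_lt_of_neg one_lt_two hθ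
  have hρ₂1 : ρ₂ < 1 := Real.rpow_lt_one_of_one_lt_of_neg one_lt_two hαs
  have hsum : Summable fun L : ℕ => 64 * K / ε ^ 2 * (((L : ℝ) + 1) ^ 2 * (ρ₁ ^ 2) ^ L)
      + 10 * C * ρ₂ ^ L + 8 * B / ε * ρ₁ ^ L :=
    (((summable_succ_sq_mul_geometric (by positivity) (by nlinarith)).mul_left _).add
      ((summable_geometric_of_lt_one hρ₂0.le hρ₂1).mul_left _)).add
      ((summable_geometric_of_lt_one hρ₁0.le hρ₁1).mul_left _)
  rw [ENNReal.tsum_mul_left]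
  refine ENNReal.mul_lt_top (by simp) (lt_of_le_of_lt ?_ hsum.tsum_ofReal_lt_top)
  refine ENNReal.tsum_le_tsum fun L => ?_
  set r := ⌈(2 : ℝ) ^ (α * L)⌉₊ with hr
  have hx1 : (1 : ℝ) ≤ 2 ^ (α * L) := Real.one_le_rpow one_le_two (by positivity)
  have hrx : (2 : ℝ) ^ (α * L) ≤ r := Nat.le_ceil _
  have hr1 : (1 : ℝ) ≤ r := hx1.trans hrx
  have hrpos : 0 < r := by exact_mod_cast (zero_lt_one.trans_le hr1)
  have hr2 : (r : ℝ) ≤ 2 * 2 ^ (α * L) := by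
    linarith [(Nat.ceil_lt_add_one (zero_le_one.trans hx1) : (r : ℝ) < _)]
  have hqr : (q L : ℝ) = 2 * r := by rw [hq]; push_cast; rfl
  have h2L : (2 : ℝ) ^ (L : ℕ) = 2 ^ (L : ℝ) := (Real.rpow_natCast 2 L).symm
  have hρ₁L : ρ₁ ^ L = 2 ^ L * 2 ^ (α * L) / 2 ^ (θ * L) := by
    rw [hρ₁, ← Real.rpow_natCast, ← Real.rpow_mul zero_le_two, h2L, ← Real.rpow_add two_pos,
      ← Real.rpow_sub two_pos]
    congr 1
    ring
  have hρ₂L : 2 ^ L * (2 ^ (α * L)) ^ (-(s + 2)) = ρ₂ ^ L := by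
    rw [hρ₂, ← Real.rpow_natCast (2 ^ (1 - α * (s + 2))), ← Real.rpow_mul zero_le_two, h2L,
      ← Real.rpow_mul zero_le_two,
      ← Real.rpow_add two_pos]
    congr 1
    ring
  have hxL : (2 : ℝ) ^ (α * L) ≤ 2 ^ L := by
    rw [h2L]
    refine Real.rpow_le_rpow_of_exponent_le one_le_two ?_
    exact mul_le_of_le_one_left (Nat.cast_nonneg L) hα1
  set y : ℝ := 2 ^ (θ * L) with hy
  have hy0 : 0 < y := by positivity
  set x : ℝ := 2 ^ (α * L) with hx
  rw [ENNReal.ofReal_add (by positivity) (by positivity),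
    ENNReal.ofReal_add (by positivity) (by positivity)]
  refine add_le_add (add_le_add ?_ ?_) ?_
  · apply ENNReal.ofReal_le_ofReal
    have e : 64 * K / ε ^ 2 * (((L : ℝ) + 1) ^ 2 * (ρ₁ ^ 2) ^ L)
        = ((L : ℝ) + 1) ^ 2 * (K * (2 ^ L * (2 * (2 * (2 * x))) ^ 2) * 2 ^ L) / (ε * y) ^ 2 := by
      rw [← pow_mul, mul_comm 2 L, pow_mul, hρ₁L]
      field_simp
      ring
    rw [e, hqr]
    gcongr
  · have hm : ((2 ^ L / (3 * q L) + 2 : ℕ) : ℝ) ≤ 5 * 2 ^ L / r := by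
      have h1 : ((2 ^ L / (3 * q L) : ℕ) : ℝ) ≤ 2 ^ L / r := by
        refine Nat.cast_div_le.trans ?_
        push_cast
        rw [hqr]
        gcongr
        linarith
      have h2 : (2 : ℝ) ≤ 4 * 2 ^ L / r := by
        rw [le_div_iff₀ (by linarith)]
        linarith
      push_cast at h1 ⊢
      have h3 : (5 : ℝ) * 2 ^ L / r = 2 ^ L / r + 4 * 2 ^ L / r := by ring
      linarith
    calc ((2 ^ L / (3 * q L) + 2 : ℕ) : ℝ≥0∞) * (2 * β (q L))
        ≤ ENNReal.ofReal (5 * 2 ^ L / r)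
          * (2 * ENNReal.ofReal (C * (r : ℝ) ^ (-(s + 1)))) := by
          gcongr
          · rw [← ENNReal.ofReal_natCast]
            exact ENNReal.ofReal_le_ofReal hm
          · rw [hq]
            exact hβ r hrpos
      _ = ENNReal.ofReal (10 * C * (2 ^ L * (r : ℝ) ^ (-(s + 2)))) := by
          rw [← ENNReal.ofReal_ofNat 2, ← ENNReal.ofReal_mul (by positivity),
            ← ENNReal.ofReal_mul (by positivity)]
          congr 1
          have : (r : ℝ) ^ (-(s + 2)) = (r : ℝ) ^ (-(s + 1)) / r := by
            rw [← Real.rpow_sub_one (by linarith)]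
            congr 1
            ring
          rw [this]
          field_simp
          ring
      _ ≤ ENNReal.ofReal (10 * C * ρ₂ ^ L) := by
          apply ENNReal.ofReal_le_ofReal
          rw [← hρ₂L]
          gcongr 10 * C * (2 ^ L * ?_)
          exact Real.rpow_le_rpow_of_nonpos (by linarith) hrx (by linarith)
  · have e : (2 : ℝ≥0∞) ^ L * (2 * (q L : ℝ≥0∞)) * ENNReal.ofReal B
        = ENNReal.ofReal (2 ^ L * (2 * (2 * r)) * B) := by
      rw [ENNReal.ofReal_mul (by positivity), ENNReal.ofReal_mul (by positivity), ← hqr,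
        ENNReal.ofReal_mul zero_le_two, ENNReal.ofReal_pow zero_le_two, ENNReal.ofReal_ofNat,
        ENNReal.ofReal_natCast]
    rw [e, ← ENNReal.ofReal_div_of_pos (by positivity)]
    apply ENNReal.ofReal_le_ofReal
    have e2 : 8 * B / ε * ρ₁ ^ L = 2 ^ L * (2 * (2 * (2 * x))) * B / (ε * y) := by
      rw [hρ₁L]
      field_simp
      ring
    rw [e2]
    gcongr

/-- If the maxima over the dyadic scales are eventually small, then so is the sequence. -/
lemma tendsto_of_eventually_dyadic {θ : ℝ} (hθ : 0 < θ) {u : ℕ → ℝ} (hu : ∀ n, 0 ≤ u n)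
    (hd : ∀ k : ℕ, ∀ᶠ L : ℕ in atTop, ∀ n ≤ 2 ^ L,
      u n ≤ 12 * (1 / ((k : ℝ) + 1) * (2 : ℝ) ^ (θ * L))) :
    Tendsto (fun n : ℕ => 1 / (n : ℝ) ^ θ * u n) atTop (𝓝 0) := by
  rw [Metric.tendsto_atTop]
  intro ε hε
  obtain ⟨k, hk⟩ := exists_nat_one_div_lt (show 0 < ε / (12 * (2 : ℝ) ^ θ) by positivity)
  obtain ⟨L₀, hL₀⟩ := eventually_atTop.1 (hd k)
  refine ⟨2 ^ L₀, fun n hn => ?_⟩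
  have hn0 : 0 < n := lt_of_lt_of_le (by positivity) hn
  have hn0' : (0 : ℝ) < n := by exact_mod_cast hn0
  -- `2 ^ L ≤ n < 2 ^ (L + 1)`
  set L := Nat.log 2 n with hL
  have hLn : 2 ^ L ≤ n := Nat.pow_log_le_self 2 hn0.ne'
  have hnL : n < 2 ^ (L + 1) := Nat.lt_pow_succ_log_self one_lt_two n
  have hL₀L : L₀ ≤ L + 1 := by
    have : L₀ < L + 1 := (Nat.pow_lt_pow_iff_right one_lt_two).1 (hn.trans_lt hnL)
    omega
  have h1 := hL₀ (L + 1) hL₀L n hnL.le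
  have h2 : (2 : ℝ) ^ (θ * ((L + 1 : ℕ) : ℝ)) ≤ 2 ^ θ * (n : ℝ) ^ θ := by
    push_cast
    rw [mul_add, mul_one, Real.rpow_add two_pos, mul_comm, mul_comm θ, Real.rpow_mul zero_le_two,
      Real.rpow_natCast]
    gcongr
    exact_mod_cast hLn
  have hnθ : (0 : ℝ) < (n : ℝ) ^ θ := by positivity
  have hun := hu n
  rw [Real.dist_eq, sub_zero, abs_of_nonneg (by positivity), one_div, inv_mul_lt_iff₀ hnθ]
  calc u n ≤ 12 * (1 / ((k : ℝ) + 1) * (2 : ℝ) ^ (θ * ((L + 1 : ℕ) : ℝ))) := h1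
    _ ≤ 12 * (1 / ((k : ℝ) + 1) * (2 ^ θ * (n : ℝ) ^ θ)) := by gcongr
    _ < 12 * (ε / (12 * (2 : ℝ) ^ θ) * (2 ^ θ * (n : ℝ) ^ θ)) := by gcongr
    _ = (n : ℝ) ^ θ * ε := by
      field_simp

end UStat

theorem theorem4
    {S H Ω Ω' : Type*}
    [MetricSpace S] [TopologicalSpace.SeparableSpace S] [MeasurableSpace S] [BorelSpace S]
    [NormedAddCommGroup H] [InnerProductSpace ℝ H] [CompleteSpace H]
    [TopologicalSpace.SeparableSpace H] [MeasurableSpace H] [BorelSpace H]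
    [MeasurableSpace Ω] (P : Measure Ω) [IsProbabilityMeasure P]
    (X : ℤ → Ω → S) (hX : ∀ i, Measurable (X i)) (hstat : UStat.IsStrictlyStationary P X)
    (h : S × S → H) (hh : Measurable h)
    -- `Y` and `Y'` are a copy of `X 1` and an independent copy of it, on some probability space
    [MeasurableSpace Ω'] (P' : Measure Ω') [IsProbabilityMeasure P']
    (Y Y' : Ω' → S) (hY : Measurable Y) (hY' : Measurable Y')
    (hYX : IdentDistrib Y (X 1) P' P) (hY'X : IdentDistrib Y' (X 1) P' P)
    (hindep : IndepFun Y Y' P')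
    -- degeneracy of the kernel
    (hdeg : P'[fun ω => h (Y ω, Y' ω) | MeasurableSpace.comap Y inferInstance] =ᵐ[P'] 0)
    (hdeg' : P'[fun ω => h (Y ω, Y' ω) | MeasurableSpace.comap Y' inferInstance] =ᵐ[P'] 0)
    (p δ : ℝ) (hp1 : 1 < p) (hp2 : p < 2) (hδ : 0 < δ) (hpδ : 2 ≤ p + δ)
    (hmom : ∫⁻ ω, ‖h (Y ω, Y' ω)‖ₑ ^ (p + δ) ∂P' < ∞)
    (hL1 : (⨆ (j : ℤ) (_ : 2 ≤ j), ∫⁻ ω, ‖h (X 1 ω, X j ω)‖ₑ ∂P) < ∞)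
    (η : ℝ) (hη : 0 < η)
    (hmix : ∑' k : ℕ+, ENNReal.ofReal (((k : ℕ) : ℝ) ^ (2 * (p - 1) / (2 - p) + η)) *
      UStat.betaMix P X (k : ℕ) < ∞) :
    ∀ᵐ ω ∂P, Tendsto (fun n : ℕ => 1 / (n : ℝ) ^ (2 / p) * ‖UStat.uStat h X n ω‖)
      atTop (𝓝 0) := by 
  have : SecondCountableTopology H := UniformSpace.secondCountable_of_separable H
  have hν : IsProbabilityMeasure (P.map (X 1)) :=
    Measure.isProbabilityMeasure_map (hX 1).aemeasurable
  have hd : UStat.IsDegenerate (P.map (X 1)) h :=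
    UStat.isDegenerate_of_condExp hY hY' hYX.map_eq hY'X.map_eq hindep hh hdeg hdeg' hpδ hmom
  have h2p : 0 < 2 - p := by linarith
  have hp0 : 0 < p := by linarith
  have hs : 0 ≤ 2 * (p - 1) / (2 - p) + η := by
    have : 0 ≤ p - 1 := by linarith
    positivity
  obtain ⟨C, hC, hβ⟩ := UStat.exists_betaMix_le P X hs hmix
  obtain ⟨hθ, hαs⟩ := UStat.exponent_bounds hp1 hp2 hη
  set B := ⨆ (j : ℤ) (_ : 2 ≤ j), ∫⁻ ω, ‖h (X 1 ω, X j ω)‖ₑ ∂P with hB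
  let q : ℕ → ℕ := fun L => 2 * ⌈(2 : ℝ) ^ ((1 - p / 2) * L)⌉₊
  have hq : ∀ L, 0 < q L := fun L =>
    Nat.mul_pos two_pos (Nat.ceil_pos.2 (by positivity))
  have hev : ∀ k : ℕ, ∀ᵐ ω ∂P, ∀ᶠ L : ℕ in atTop, ∀ n ≤ 2 ^ L,
      ‖UStat.uStat h X n ω‖ ≤ 12 * (1 / ((k : ℝ) + 1) * (2 : ℝ) ^ (2 / p * L)) := by
    intro k
    have hε : (0 : ℝ) < 1 / ((k : ℝ) + 1) := by positivity
    have htail := UStat.tsum_tail_lt_top (by linarith) (by linarith) hs hθ hαs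
      (integral_nonneg fun z => by positivity :
        0 ≤ ∫ z, ‖h z‖ ^ 2 ∂((P.map (X 1)).prod (P.map (X 1))))
      (ENNReal.toReal_nonneg : 0 ≤ B.toReal) hC hε hβ q fun L => rfl
    rw [ENNReal.ofReal_toReal hL1.ne] at htail
    have hBC := measure_setOfPred_frequently_eq_zero (μ := P)
      (p := fun (L : ℕ) ω => ∃ n ≤ 2 ^ L,
        12 * (1 / ((k : ℝ) + 1) * (2 : ℝ) ^ (2 / p * L)) < ‖UStat.uStat h X n ω‖)
      (ne_top_of_le_ne_top htail.ne (ENNReal.tsum_le_tsum fun L =>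
        UStat.measure_exists_uStat_gt_le hstat hX hd (hq L) L (by positivity)))
    have : ∀ᵐ ω ∂P, ¬∃ᶠ L : ℕ in atTop, ∃ n ≤ 2 ^ L,
        12 * (1 / ((k : ℝ) + 1) * (2 : ℝ) ^ (2 / p * L)) < ‖UStat.uStat h X n ω‖ := by
      rw [ae_iff]
      simpa only [not_not] using hBC
    filter_upwards [this] with ω hω
    simpa only [not_frequently, not_exists, not_and, not_lt] using hω
  filter_upwards [ae_all_iff.2 hev] with ω hω
  exact UStat.tendsto_of_eventually_dyadic (by positivity) (fun n => norm_nonneg _) hω
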